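/- For complex $a,q$ with $|q|<1$ put $(a;q)_n=\prod_{k=0}^{n-1}(1-aq^k)$, $(a;q)_\infty=\prod_{k=0}^{\infty}(1-aq^k)$, and let $\chi(q)=(-q;q^2)_\infty$. Let $$G(q)=\sum_{n=0}^\infty\frac{q^{n^2}}{(q;q)_n},\qquad H(q)=\sum_{n=0}^\infty\frac{q^{n(n+1)}}{(q;q)_n}$$ be the Rogers--Ramanujan functions, and for positive integers $r,s$ let $$U(r,s,q)=\begin{cases}G(q^r)G(q^s)+q^{(s+r)/5}H(q^r)H(q^s)&\text{if } s+r\equiv0\pmod 5,\\ H(q^r)G(q^s)-q^{(s-r)/5}G(q^r)H(q^s)&\text{if } s-r\equiv0\pmod 5,\end{cases}$$ the first case taking precedence if both apply (so $U(1,19,q)=G(q)G(q^{19})+q^4H(q)H(q^{19})$). Theorem. For every complex $q$ with $|q|<1$, with $Q=q^{19}$, the following two identities hold: $$4\,U(1,19,q)\,U(1,19,q^4)=3\chi(q)^2\chi(Q)^2+\chi(-q)^2\chi(-Q)^2+\frac{4q^5}{\chi(-q^2)^2\chi(-Q^2)^2},$$ $$4q\,U(1,19,q)\,U(1,19,-q)=\chi(q)^2\chi(Q)^2-\chi(-q)^2\chi(-Q)^2+\frac{12q^5}{\chi(-q^2)^2\chi(-Q^2)^2}.$$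 -/

import Mathlib

open Filter Topology

/-- The finite `q`-shifted factorial `(a;q)_n = ∏_{k<n} (1 - a q^k)`. -/
noncomputable def qFac (a q : ℂ) (n : ℕ) : ℂ :=
  ∏ k ∈ Finset.range n, (1 - a * q ^ k)

/-- The infinite `q`-shifted factorial `(a;q)_∞ = ∏_{k≥0} (1 - a q^k)`, for `|q| < 1`. -/
noncomputable def qFacInf (a q : ℂ) : ℂ :=
  ∏' k : ℕ, (1 - a * q ^ k)

/-- The Rogers--Ramanujan function `G(q) = ∑ q^(n²) / (q;q)_n`, for `|q| < 1`. -/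
noncomputable def rrG (q : ℂ) : ℂ :=
  ∑' n : ℕ, q ^ (n ^ 2) / qFac q q n

/-- The Rogers--Ramanujan function `H(q) = ∑ q^(n(n+1)) / (q;q)_n`, for `|q| < 1`. -/
noncomputable def rrH (q : ℂ) : ℂ :=
  ∑' n : ℕ, q ^ (n * (n + 1)) / qFac q q n

/-- Ramanujan's function `U(r,s,q)`, given by
`G(q^r) G(q^s) + q^((s+r)/5) H(q^r) H(q^s)` if `s + r ≡ 0 (mod 5)` and by
`H(q^r) G(q^s) - q^((s-r)/5) G(q^r) H(q^s)` if `s - r ≡ 0 (mod 5)`.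
(It is not defined for other `r`, `s`; the value there is set to `0`.) -/
noncomputable def rrU (r s : ℕ) (q : ℂ) : ℂ :=
  if ((s : ℤ) + r) % 5 = 0 then
    rrG (q ^ r) * rrG (q ^ s) + q ^ (((s : ℤ) + r) / 5) * rrH (q ^ r) * rrH (q ^ s)
  else if ((s : ℤ) - r) % 5 = 0 then
    rrH (q ^ r) * rrG (q ^ s) - q ^ (((s : ℤ) - r) / 5) * rrG (q ^ r) * rrH (q ^ s)
  else 0

/-- The function `χ(q) = (-q;q²)_∞`, for `|q| < 1`. -/
noncomputable def chi (q : ℂ) : ℂ :=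
  qFacInf (-q) (q ^ 2)

/-- For `|q| < 1` the infinite product defining `(a;q)_∞` converges. -/
theorem multipliable_qFacInf (a : ℂ) {q : ℂ} (hq : ‖q‖ < 1) :
    Multipliable fun k : ℕ => 1 - a * q ^ k := by
  have h : Summable fun k : ℕ => ‖-(a * q ^ k)‖ := by
    simpa [norm_mul, norm_pow] using
      (summable_geometric_of_lt_one (norm_nonneg q) hq).mul_left ‖a‖
  simpa [sub_eq_add_neg] using multipliable_one_add_of_summable h

/-- For `|q| < 1`, `(a;q)_∞` is the limit of `(a;q)_n` as `n → ∞`. -/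
theorem tendsto_qFac (a : ℂ) {q : ℂ} (hq : ‖q‖ < 1) :
    Tendsto (qFac a q) atTop (𝓝 (qFacInf a q)) :=
  (multipliable_qFacInf a hq).tendsto_prod_tprod_nat

/-- For `|q| < 1` the finite products `(q;q)_n` do not vanish. -/
theorem qFac_self_ne_zero {q : ℂ} (hq : ‖q‖ < 1) (n : ℕ) : qFac q q n ≠ 0 := by
  refine Finset.prod_ne_zero_iff.2 fun k _ h => ?_
  have h1 : ‖q ^ (k + 1)‖ = 1 := by
    rw [pow_succ', ← sub_eq_zero.1 h, norm_one]
  rw [norm_pow] at h1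
  exact absurd h1 (pow_lt_one₀ (norm_nonneg q) hq (Nat.succ_ne_zero k)).ne

/-- For `|q| < 1` the product `χ(q)` does not vanish. -/
theorem chi_ne_zero {q : ℂ} (hq : ‖q‖ < 1) : chi q ≠ 0 := by
  have hq2 : ‖q ^ 2‖ < 1 := by
    rw [norm_pow]; exact pow_lt_one₀ (norm_nonneg q) hq two_ne_zero
  have h : Summable fun k : ℕ => ‖q * (q ^ 2) ^ k‖ := by
    simpa only [norm_mul, norm_pow] using
      (summable_geometric_of_lt_one (norm_nonneg _) hq2).mul_left ‖q‖ |>.congr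
        fun k => by simp [norm_pow]
  have h0 : ∀ k : ℕ, 1 + q * (q ^ 2) ^ k ≠ 0 := by
    intro k hk
    have h1 : ‖q ^ (2 * k + 1)‖ = 1 := by
      have : q ^ (2 * k + 1) = -1 := by linear_combination hk
      rw [this, norm_neg, norm_one]
    rw [norm_pow] at h1
    exact absurd h1 (pow_lt_one₀ (norm_nonneg q) hq (Nat.succ_ne_zero _)).ne
  have := tprod_one_add_ne_zero_of_summable h0 h
  simpa [chi, qFacInf] using this

/-- For `|q| < 1` the series defining `G(q)` and `H(q)` converge absolutely. -/
theorem summable_rr {q : ℂ} (hq : ‖q‖ < 1) :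
    (Summable fun n : ℕ => ‖q ^ (n ^ 2) / qFac q q n‖) ∧
      Summable fun n : ℕ => ‖q ^ (n * (n + 1)) / qFac q q n‖ := by
  have hne : qFacInf q q ≠ 0 := by
    have h : Summable fun k : ℕ => ‖-(q * q ^ k)‖ := by
      simpa [norm_mul, norm_pow] using
        (summable_geometric_of_lt_one (norm_nonneg q) hq).mul_left ‖q‖
    have h0 : ∀ k : ℕ, 1 + -(q * q ^ k) ≠ 0 := by
      intro k hk
      have := qFac_self_ne_zero hq (k + 1)
      rw [qFac, Finset.prod_range_succ, sub_eq_add_neg, hk, mul_zero] at this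
      exact this rfl
    simpa [qFacInf, sub_eq_add_neg] using tprod_one_add_ne_zero_of_summable h0 h
  have hb : (fun n => (qFac q q n)⁻¹) =O[atTop] (fun _ => (1 : ℝ)) :=
    ((tendsto_qFac q hq).inv₀ hne).isBigO_one ℝ
  have key : ∀ e : ℕ → ℕ, (∀ n, n ≤ e n) → Summable fun n : ℕ => ‖q ^ e n / qFac q q n‖ := by
    intro e he
    have hg : (fun n => q ^ e n) =O[atTop] (fun n : ℕ => ‖q‖ ^ n) := by
      refine Asymptotics.IsBigO.of_bound 1 (Eventually.of_forall fun n => ?_)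
      rw [norm_pow, norm_pow, norm_norm, one_mul]
      exact pow_le_pow_of_le_one (norm_nonneg q) hq.le (he n)
    refine summable_of_isBigO_nat (summable_geometric_of_lt_one (norm_nonneg q) hq) ?_
    simpa [div_eq_mul_inv] using (hg.mul hb).norm_left
  exact ⟨key _ fun n => by nlinarith [Nat.le_self_pow two_ne_zero n], key _ fun n => by nlinarith⟩

/-! Multiply out the two factors `U`. Put E(q) = (q²;q²)_∞ and θ(x,z) = ∑ x^(n²) z^n. Each resulting
term pairs a product of two values of `G`, `H` at (q, q⁴) or at (q, -q) with the same product at Q,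
so it is enough to know every such product times E.

For (q, q⁴) the mixed products are single theta series by cancellation of infinite products. For A =
G(q)G(q⁴) and B = qH(q)H(q⁴) one has A + B = χ(q)² and (A - B)E(q) = θ(q⁵,1). Since q²⁰ = qQ, the
remaining terms are AA' + BB' = ((A+B)(A'+B') + (A-B)(A'-B'))/2, with primes denoting values at Q.
For (q, -q) the unmixed products are single theta series and the mixed ones are (θ(q,q) ±
qθ(q⁵,q⁵))/(2E(q)).

What is left is one theta identity for each claim. Both come from the form K² + Kl + 5l² of
discriminant -19, restricted to even K and to odd K: completing the square in one variable gives
products of series in q⁵ and q⁹⁵, in the other products of series in q⁴ and q⁷⁶. The same device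
with determinants 4 and 1 gives A + B and (A - B)². The general splitting is `binaryTheta_eq_sum`;
the product sides rest on the Jacobi triple product and on the Rogers–Ramanujan identities, obtained
by iterating Bailey's lemma. -/

/-! ### Theta series and reciprocal q-factorials indexed by integers. -/

/-- The bilateral theta series `∑_{n ∈ ℤ} x^(n²) z^n`. -/
noncomputable def qTheta (x z : ℂ) : ℂ := ∑' n : ℤ, x ^ (n ^ 2) * z ^ n

/-- The reciprocal `1/(q;q)_m`, extended by `0` to negative integers `m`. -/
noncomputable def qFacInv (q : ℂ) (m : ℤ) : ℂ :=
  if 0 ≤ m then (qFac q q m.toNat)⁻¹ else 0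

theorem qFacInv_natCast (q : ℂ) (n : ℕ) : qFacInv q n = (qFac q q n)⁻¹ := by
  simp [qFacInv]

theorem qFacInv_of_neg (q : ℂ) {m : ℤ} (hm : m < 0) : qFacInv q m = 0 := by
  simp [qFacInv, not_le.2 hm]

theorem qFacInv_zero (q : ℂ) : qFacInv q 0 = 1 := by
  simp [qFacInv, qFac]

theorem one_sub_pow_succ_ne_zero {q : ℂ} (hq : ‖q‖ < 1) (n : ℕ) : 1 - q ^ (n + 1) ≠ 0 := by
  intro h
  have h1 : ‖q ^ (n + 1)‖ = 1 := by rw [← sub_eq_zero.1 h, norm_one]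
  rw [norm_pow] at h1
  exact absurd h1 (pow_lt_one₀ (norm_nonneg q) hq (Nat.succ_ne_zero n)).ne

theorem qFacInv_sub_one {q : ℂ} (hq : ‖q‖ < 1) (m : ℤ) :
    qFacInv q (m - 1) = (1 - q ^ m) * qFacInv q m := by
  rcases lt_trichotomy m 0 with h | rfl | h
  · rw [qFacInv_of_neg q h, qFacInv_of_neg q (by omega), mul_zero]
  · rw [qFacInv_of_neg q (by omega)]; simp
  · obtain ⟨n, rfl⟩ : ∃ n : ℕ, m = (n : ℤ) + 1 := ⟨(m - 1).toNat, by omega⟩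
    have h1 := one_sub_pow_succ_ne_zero hq n
    have h2 := qFac_self_ne_zero hq n
    have h3 : qFac q q (n + 1) = qFac q q n * (1 - q ^ (n + 1)) := by
      rw [qFac, Finset.prod_range_succ, pow_succ']; rfl
    rw [add_sub_cancel_right, qFacInv_natCast, ← Nat.cast_succ, qFacInv_natCast, zpow_natCast,
      Nat.succ_eq_add_one, h3]
    field_simp

theorem qFacInv_add_one {q : ℂ} (hq : ‖q‖ < 1) (m : ℤ) :
    qFacInv q m = (1 - q ^ (m + 1)) * qFacInv q (m + 1) := by
  simpa using qFacInv_sub_one hq (m + 1)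

theorem qFacInf_self_ne_zero {q : ℂ} (hq : ‖q‖ < 1) : qFacInf q q ≠ 0 := by
  have h : Summable fun k : ℕ => ‖-(q * q ^ k)‖ := by
    simpa [norm_mul, norm_pow] using
      (summable_geometric_of_lt_one (norm_nonneg q) hq).mul_left ‖q‖
  have h0 : ∀ k : ℕ, 1 + -(q * q ^ k) ≠ 0 := fun k hk =>
    one_sub_pow_succ_ne_zero hq k (by rw [pow_succ']; linear_combination hk)
  simpa [qFacInf, sub_eq_add_neg] using tprod_one_add_ne_zero_of_summable h0 h

theorem tendsto_qFacInv_nat {q : ℂ} (hq : ‖q‖ < 1) :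
    Tendsto (fun n : ℕ => qFacInv q n) atTop (𝓝 (qFacInf q q)⁻¹) := by
  simp_rw [qFacInv_natCast]
  exact (tendsto_qFac q hq).inv₀ (qFacInf_self_ne_zero hq)

theorem tendsto_qFacInv {q : ℂ} (hq : ‖q‖ < 1) :
    Tendsto (qFacInv q) atTop (𝓝 (qFacInf q q)⁻¹) := by
  have h : Tendsto (fun m : ℤ => m.toNat) atTop atTop :=
    tendsto_atTop.2 fun b => (eventually_ge_atTop (b : ℤ)).mono fun m hm => by omega
  refine ((tendsto_qFacInv_nat hq).comp h).congr' ?_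
  filter_upwards [eventually_ge_atTop (0 : ℤ)] with m hm
  simp [hm]

theorem exists_norm_qFacInv_le {q : ℂ} (hq : ‖q‖ < 1) :
    ∃ B : ℝ, 0 ≤ B ∧ ∀ m : ℤ, ‖qFacInv q m‖ ≤ B := by
  obtain ⟨B, hB⟩ := (Metric.isBounded_range_of_tendsto _ (tendsto_qFacInv_nat hq)).exists_norm_le
  have hB0 : 0 ≤ B := (norm_nonneg _).trans (hB _ ⟨0, rfl⟩)
  refine ⟨B, hB0, fun m => ?_⟩
  rcases lt_or_ge m 0 with h | h
  · simpa [qFacInv_of_neg q h] using hB0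
  · lift m to ℕ using h
    exact hB _ ⟨m, rfl⟩

theorem summable_norm_qTheta {x z : ℂ} (hx0 : x ≠ 0) (hx : ‖x‖ < 1) (hz : z ≠ 0) :
    Summable fun n : ℤ => ‖x ^ (n ^ 2) * z ^ n‖ := by
  have key : ∀ w : ℂ, w ≠ 0 → Summable fun n : ℕ => ‖x ^ (n ^ 2) * w ^ n‖ := by
    intro w hw
    have hne : ∀ n : ℕ, ‖x ^ (n ^ 2) * w ^ n‖ ≠ 0 := fun n =>
      norm_ne_zero_iff.2 (mul_ne_zero (pow_ne_zero _ hx0) (pow_ne_zero _ hw))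
    refine summable_of_ratio_test_tendsto_lt_one (l := 0) zero_lt_one (Eventually.of_forall hne) ?_
    have : ∀ n : ℕ, ‖‖x ^ ((n + 1) ^ 2) * w ^ (n + 1)‖‖ / ‖‖x ^ (n ^ 2) * w ^ n‖‖
        = (‖x‖ ^ 2) ^ n * (‖x‖ * ‖w‖) := by
      intro n
      rw [norm_norm, norm_norm, div_eq_iff (hne n)]
      simp only [norm_mul, norm_pow]
      ring
    simp_rw [this]
    simpa using (tendsto_pow_atTop_nhds_zero_of_lt_one (by positivity)
      (pow_lt_one₀ (norm_nonneg x) hx two_ne_zero)).mul_const (‖x‖ * ‖w‖)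
  refine Summable.of_nat_of_neg ?_ ?_
  · refine (key z hz).congr fun n => ?_
    rw [zpow_natCast, ← zpow_natCast x]; push_cast; rfl
  · refine (key z⁻¹ (inv_ne_zero hz)).congr fun n => ?_
    rw [zpow_neg, zpow_natCast, ← zpow_natCast x, inv_pow]; push_cast; rw [neg_sq]

theorem hasSum_qTheta {x z : ℂ} (hx0 : x ≠ 0) (hx : ‖x‖ < 1) (hz : z ≠ 0) :
    HasSum (fun n : ℤ => x ^ (n ^ 2) * z ^ n) (qTheta x z) :=
  (summable_norm_qTheta hx0 hx hz).of_norm.hasSum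

theorem qTheta_inv (x z : ℂ) : qTheta x z⁻¹ = qTheta x z := by
  rw [qTheta, qTheta, ← (Equiv.neg ℤ).tsum_eq]
  simp

/-- The shift n ↦ n + 1 gives quasi-periodicity; with `qTheta_inv` it normalizes the theta arguments
met later. -/
theorem qTheta_mul_sq {x z : ℂ} (hx : x ≠ 0) (hz : z ≠ 0) :
    x * z * qTheta x (z * x ^ 2) = qTheta x z := by
  rw [qTheta, qTheta, ← tsum_mul_left, ← (Equiv.addRight (1 : ℤ)).tsum_eq (fun n : ℤ => x ^ (n ^ 2) * z ^ n)]
  refine tsum_congr fun n => ?_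
  simp only [Equiv.coe_addRight]
  rw [mul_zpow, ← zpow_natCast x 2, ← zpow_mul, zpow_add_one₀ hz,
    show (n + 1) ^ 2 = n ^ 2 + 2 * n + 1 by ring, zpow_add₀ hx, zpow_add₀ hx, zpow_one]
  push_cast
  ring

/-! ### The finite and the infinite triple product -/

/-- With p = x², A = N + j and B = M + 1 - j, write 1 - p^(A+B) = (1 - p^B) + p^B(1 - p^A). Each new
term is then an old term plus z x^(2M+1) times the old term at j - 1, up to the common denominator.
-/
theorem hasSum_tripleProduct_succ {x z s : ℂ} (hx0 : x ≠ 0) (hx : ‖x‖ < 1) (hz : z ≠ 0) {M N : ℕ}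
    (h : HasSum (fun j : ℤ => x ^ (j ^ 2) * z ^ j *
      (qFacInv (x ^ 2) (N + j) * qFacInv (x ^ 2) (M - j))) s) :
    HasSum (fun j : ℤ => x ^ (j ^ 2) * z ^ j *
      (qFacInv (x ^ 2) (N + j) * qFacInv (x ^ 2) ((M + 1 : ℕ) - j)))
      (s * (1 + z * x ^ (2 * M + 1)) / (1 - (x ^ 2) ^ (M + N + 1))) := by
  have hp : ‖x ^ 2‖ < 1 := by
    rw [norm_pow]; exact pow_lt_one₀ (norm_nonneg x) hx two_ne_zero
  have hne := one_sub_pow_succ_ne_zero hp (M + N)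
  have h' := (h.add (((Equiv.subRight (1 : ℤ)).hasSum_iff.2 h).mul_left
    (z * x ^ (2 * M + 1)))).div_const (1 - (x ^ 2) ^ (M + N + 1))
  have hs : s * (1 + z * x ^ (2 * M + 1)) = s + z * x ^ (2 * M + 1) * s := by ring
  rw [hs]
  refine h'.congr_fun fun j => ?_
  simp only [Function.comp, Equiv.subRight_apply]
  rw [eq_div_iff hne]
  have e1 := qFacInv_sub_one hp (N + j)
  have e2 := qFacInv_sub_one hp ((M + 1 : ℕ) - j)
  rw [show ((M + 1 : ℕ) : ℤ) - j - 1 = M - j by push_cast; ring] at e2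
  rw [show (N : ℤ) + (j - 1) = N + j - 1 by ring, show (M : ℤ) - (j - 1) = (M + 1 : ℕ) - j by
    push_cast; ring, e1, e2]
  have z1 : z ^ j = z * z ^ (j - 1) := by rw [← zpow_one_add₀ hz]; ring_nf
  have z2 : x ^ (2 * M + 1) * x ^ ((j - 1) ^ 2) =
      x ^ (j ^ 2) * (x ^ 2) ^ (((M + 1 : ℕ) : ℤ) - j) := by
    rw [← zpow_natCast x 2, ← zpow_mul, ← zpow_natCast x, ← zpow_add₀ hx0, ← zpow_add₀ hx0]
    congr 1; push_cast; ring
  have z3 : (x ^ 2) ^ (M + N + 1) =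
      (x ^ 2) ^ (((M + 1 : ℕ) : ℤ) - j) * (x ^ 2) ^ ((N : ℤ) + j) := by
    rw [← zpow_add₀ (pow_ne_zero 2 hx0), ← zpow_natCast]
    congr 1; push_cast; ring
  rw [z3, z1]
  linear_combination (-(z * z ^ (j - 1) * (1 - (x ^ 2) ^ ((N : ℤ) + j)) *
    qFacInv (x ^ 2) (↑N + j) * qFacInv (x ^ 2) (↑(M + 1) - j))) * z2

theorem qFac_succ (a q : ℂ) (n : ℕ) : qFac a q (n + 1) = qFac a q n * (1 - a * q ^ n) := by
  rw [qFac, Finset.prod_range_succ]; rfl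

theorem qFac_self_succ (q : ℂ) (n : ℕ) : qFac q q (n + 1) = qFac q q n * (1 - q ^ (n + 1)) := by
  rw [qFac_succ, pow_succ']

/-- Reflection j ↦ -j exchanges M and N, so induction on M alone suffices. -/
theorem hasSum_tripleProduct_neg {x z s : ℂ} {M N : ℕ}
    (h : HasSum (fun j : ℤ => x ^ (j ^ 2) * z ^ j *
      (qFacInv (x ^ 2) (N + j) * qFacInv (x ^ 2) (M - j))) s) :
    HasSum (fun j : ℤ => x ^ (j ^ 2) * z⁻¹ ^ j *
      (qFacInv (x ^ 2) (M + j) * qFacInv (x ^ 2) (N - j))) s := by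
  refine ((Equiv.neg ℤ).hasSum_iff.2 h).congr_fun fun j => ?_
  simp only [Function.comp, Equiv.neg_apply, neg_sq, inv_zpow', sub_neg_eq_add,
    ← sub_eq_add_neg]
  ring

/-- The finite form of the Jacobi triple product identity. -/
theorem hasSum_tripleProduct {x z : ℂ} (hx0 : x ≠ 0) (hx : ‖x‖ < 1) (hz : z ≠ 0) (M N : ℕ) :
    HasSum (fun j : ℤ => x ^ (j ^ 2) * z ^ j *
      (qFacInv (x ^ 2) (N + j) * qFacInv (x ^ 2) (M - j)))
      (qFac (-(z * x)) (x ^ 2) M * qFac (-(z⁻¹ * x)) (x ^ 2) N / qFac (x ^ 2) (x ^ 2) (M + N)) := by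
  -- The constant c holds the factors already accumulated in N. The step is used with z⁻¹ from M = N
  -- = 0, then, after reflection, with z.
  have step : ∀ (w : ℂ) (c : ℂ) (N : ℕ), w ≠ 0 → HasSum (fun j : ℤ => x ^ (j ^ 2) * w ^ j *
      (qFacInv (x ^ 2) (N + j) * qFacInv (x ^ 2) ((0 : ℕ) - j)))
        (c / qFac (x ^ 2) (x ^ 2) N) → ∀ M : ℕ, HasSum (fun j : ℤ => x ^ (j ^ 2) * w ^ j *
      (qFacInv (x ^ 2) (N + j) * qFacInv (x ^ 2) (M - j)))
        (qFac (-(w * x)) (x ^ 2) M * c / qFac (x ^ 2) (x ^ 2) (M + N)) := by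
    intro w c N hw h M
    induction M with
    | zero => simpa [qFac] using h
    | succ M ih =>
      convert hasSum_tripleProduct_succ hx0 hx hw ih using 1
      rw [show M + 1 + N = M + N + 1 by ring, qFac_self_succ, qFac_succ,
        show 1 - -(w * x) * (x ^ 2) ^ M = 1 + w * x ^ (2 * M + 1) by ring,
        div_mul_eq_mul_div, div_div]
      ring
  have h0 : HasSum (fun j : ℤ => x ^ (j ^ 2) * z⁻¹ ^ j *
      (qFacInv (x ^ 2) ((0 : ℕ) + j) * qFacInv (x ^ 2) ((0 : ℕ) - j)))
      (1 / qFac (x ^ 2) (x ^ 2) 0) := by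
    convert hasSum_single (0 : ℤ) ?_ using 1
    · simp [qFac, qFacInv_zero]
    · intro j hj
      rcases lt_or_gt_of_ne hj with h | h
      · rw [qFacInv_of_neg _ (m := ((0 : ℕ) : ℤ) + j) (by push_cast; omega)]; simp
      · rw [qFacInv_of_neg _ (m := ((0 : ℕ) : ℤ) - j) (by push_cast; omega)]; simp
  have h1 := hasSum_tripleProduct_neg (step z⁻¹ 1 0 (inv_ne_zero hz) h0 N)
  rw [inv_inv, mul_one, add_zero] at h1
  exact step z _ N hz h1 M

theorem tendsto_int_add_atTop (j : ℤ) : Tendsto (fun n : ℕ => (n : ℤ) + j) atTop atTop :=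
  tendsto_atTop_add_const_right _ _ tendsto_natCast_atTop_atTop

/-- Dominated passage to the limit in `∑_j a_j / ((q;q)_(n-j) (q;q)_(n+c+j))`. -/
theorem tendsto_tsum_qFacInv {q : ℂ} (hq : ‖q‖ < 1) {a : ℤ → ℂ} (ha : Summable fun j => ‖a j‖)
    (c : ℕ) :
    Tendsto (fun n : ℕ => ∑' j : ℤ, a j * (qFacInv q (((n + c : ℕ) : ℤ) + j) * qFacInv q (n - j)))
      atTop (𝓝 ((∑' j : ℤ, a j) * ((qFacInf q q)⁻¹ * (qFacInf q q)⁻¹))) := by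
  obtain ⟨B, hB0, hB⟩ := exists_norm_qFacInv_le hq
  rw [← tsum_mul_right]
  refine tendsto_tsum_of_dominated_convergence (bound := fun j => ‖a j‖ * (B * B))
    (ha.mul_right _) (fun j => ?_) (Eventually.of_forall fun n j => ?_)
  · refine tendsto_const_nhds.mul (((tendsto_qFacInv hq).comp ?_).mul
      ((tendsto_qFacInv hq).comp ?_))
    · simpa [add_assoc] using tendsto_int_add_atTop (c + j)
    · simpa [sub_eq_add_neg] using tendsto_int_add_atTop (-j)
  · rw [norm_mul, norm_mul]
    gcongr <;> apply hB

/-- The Jacobi triple product identity. -/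
theorem qTheta_eq_prod {x z : ℂ} (hx0 : x ≠ 0) (hx : ‖x‖ < 1) (hz : z ≠ 0) :
    qTheta x z = qFacInf (x ^ 2) (x ^ 2) * qFacInf (-(z * x)) (x ^ 2) *
      qFacInf (-(z⁻¹ * x)) (x ^ 2) := by
  have hp : ‖x ^ 2‖ < 1 := by
    rw [norm_pow]; exact pow_lt_one₀ (norm_nonneg x) hx two_ne_zero
  have hne := qFacInf_self_ne_zero hp
  have h1 := tendsto_tsum_qFacInv hp (summable_norm_qTheta hx0 hx hz) 0
  have h2 : Tendsto (fun n : ℕ => qFac (-(z * x)) (x ^ 2) n * qFac (-(z⁻¹ * x)) (x ^ 2) n /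
      qFac (x ^ 2) (x ^ 2) (n + n)) atTop (𝓝 (qFacInf (-(z * x)) (x ^ 2) *
        qFacInf (-(z⁻¹ * x)) (x ^ 2) / qFacInf (x ^ 2) (x ^ 2))) :=
    ((tendsto_qFac _ hp).mul (tendsto_qFac _ hp)).div ((tendsto_qFac _ hp).comp
      (tendsto_atTop_mono (fun n => Nat.le_add_right n n) tendsto_id)) hne
  have h3 := tendsto_nhds_unique (h1.congr fun n => (hasSum_tripleProduct hx0 hx hz n n).tsum_eq) h2
  rw [qTheta]
  rw [← mul_assoc, ← div_eq_mul_inv, ← div_eq_mul_inv, div_left_inj' hne, div_eq_iff hne] at h3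
  rw [h3]
  ring

/-! ### The Rogers--Ramanujan identities -/

/-- Negative indices kill all terms outside an interval. The shape `b + j` explains the `0 + i` in
`hasSum_qVandermonde`. -/
theorem finite_support_qFacInv_mul (q : ℂ) (f : ℤ → ℂ) (a b : ℤ) :
    (Function.support fun j : ℤ => f j * (qFacInv q (a - j) * qFacInv q (b + j))).Finite := by
  refine (Set.finite_Icc (-b) a).subset fun j hj => ?_
  by_contra h
  rw [Set.mem_Icc, not_and_or, not_le, not_le] at h
  apply hj
  rcases h with h | h
  · simp [qFacInv_of_neg q (m := b + j) (by omega)]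
  · simp [qFacInv_of_neg q (m := a - j) (by omega)]

/-- A `q`-analogue of the Vandermonde convolution. -/
theorem hasSum_qVandermonde {q : ℂ} (hq0 : q ≠ 0) (hq : ‖q‖ < 1) (N m : ℤ) :
    HasSum (fun i : ℤ => q ^ (i * (i + m)) * qFacInv q (i + m) * (qFacInv q (N - i) * qFacInv q (0 + i)))
      (qFacInv q N * qFacInv q (N + m)) := by
  rcases lt_or_ge N 0 with hN | hN
  · rw [qFacInv_of_neg q hN, zero_mul]
    convert hasSum_zero using 2 with i
    rcases lt_or_ge i 0 with h | h
    · rw [qFacInv_of_neg q (m := 0 + i) (by omega)]; simp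
    · rw [qFacInv_of_neg q (m := N - i) (by omega)]; simp
  lift N to ℕ using hN
  induction N generalizing m with
  | zero =>
    convert hasSum_single (0 : ℤ) ?_ using 1
    · simp [qFacInv_zero]
    · intro j hj
      rcases lt_or_gt_of_ne hj with h | h
      · rw [qFacInv_of_neg _ (m := 0 + j) (by omega)]; simp
      · rw [qFacInv_of_neg _ (m := ((0 : ℕ) : ℤ) - j) (by push_cast; omega)]; simp
  | succ N ih =>
    have hne := one_sub_pow_succ_ne_zero hq N
    -- From 1 - q^(N+1) = q^i(1 - q^(N+1-i)) + (1 - q^i), each term for N + 1 is the term for (N, m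
    -- + 1), minus u i, plus u (i - 1); the last two cancel after summation.
    let u : ℤ → ℂ := fun i => q ^ ((i + 1) * (i + 1 + m)) * qFacInv q (i + 1 + m) *
      (qFacInv q (N - i) * qFacInv q (0 + i))
    have hu : HasSum u (∑' i, u i) :=
      (summable_of_hasFiniteSupport (finite_support_qFacInv_mul q _ _ _)).hasSum
    have h := ((((ih (m + 1)).sub hu).add ((Equiv.subRight (1 : ℤ)).hasSum_iff.2 hu))).div_const
      (1 - q ^ (N + 1))
    rw [sub_add_cancel] at h
    have e0 := qFacInv_add_one hq N
    rw [← Nat.cast_succ, zpow_natCast] at e0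
    rw [e0, mul_assoc, mul_div_cancel_left₀ _ hne] at h
    rw [show ((N + 1 : ℕ) : ℤ) + m = N + (m + 1) by push_cast; ring]
    refine h.congr_fun fun i => ?_
    simp only [Function.comp, Equiv.subRight_apply, u]
    rw [eq_div_iff hne]
    have e1 := qFacInv_add_one hq (i + m)
    have e2 := qFacInv_sub_one hq i
    have e3 := qFacInv_sub_one hq ((N + 1 : ℕ) - i)
    rw [show ((N + 1 : ℕ) : ℤ) - i - 1 = N - i by push_cast; ring] at e3
    have z1 : q ^ (i * (i + (m + 1))) = q ^ (i * (i + m)) * q ^ i := by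
      rw [← zpow_add₀ hq0]; ring_nf
    have z2 : q ^ ((i + 1) * (i + 1 + m)) = q ^ (i * (i + m)) * q ^ i * q ^ (i + m + 1) := by
      rw [← zpow_add₀ hq0, ← zpow_add₀ hq0]; ring_nf
    have z3 : q ^ (N + 1) = q ^ i * q ^ (((N + 1 : ℕ) : ℤ) - i) := by
      rw [← zpow_add₀ hq0, ← zpow_natCast]; ring_nf
    rw [show i - 1 + 1 = i by ring, show (N : ℤ) - (i - 1) = (N + 1 : ℕ) - i by push_cast; ring,
      zero_add, zero_add, e2, e3, z1, z2, z3, show i + 1 + m = i + m + 1 by ring,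
      show i + (m + 1) = i + m + 1 by ring, e1]
    ring

/-- Bailey's lemma in the limiting case that multiplies the terms by `q^(j(j+c))`. -/
theorem hasSum_bailey {q : ℂ} (hq0 : q ≠ 0) (hq : ‖q‖ < 1) {c : ℕ} {w β : ℤ → ℂ}
    (h : ∀ n : ℤ, HasSum (fun j : ℤ => w j * (qFacInv q (n - j) * qFacInv q (n + c + j))) (β n))
    (n : ℤ) :
    HasSum (fun j : ℤ => w j * q ^ (j * (j + c)) * (qFacInv q (n - j) * qFacInv q (n + c + j)))
      (∑' k : ℤ, q ^ (k * (k + c)) * qFacInv q (n - k) * β k) := by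
  -- Bailey's lemma is an interchange of a finite double sum: summing over k first is a
  -- q-Vandermonde sum with parameters (n - j, 2j + c), summing over j first gives the β-side.
  let F : ℤ × ℤ → ℂ := fun p => w p.1 * (q ^ (p.2 * (p.2 + c)) * qFacInv q (n - p.2) *
    (qFacInv q (p.2 - p.1) * qFacInv q (p.2 + c + p.1)))
  have hF : Summable F := by
    refine summable_of_hasFiniteSupport
      (((Set.finite_Icc (-(n + c)) n).prod (Set.finite_Icc (-(c : ℤ)) n)).subset fun p hp => ?_)
    by_contra hc
    rw [Set.mem_prod, Set.mem_Icc, Set.mem_Icc] at hc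
    apply hp
    have : n - p.2 < 0 ∨ p.2 - p.1 < 0 ∨ p.2 + c + p.1 < 0 := by omega
    rcases this with h | h | h <;> simp [F, qFacInv_of_neg q h]
  have h1 : ∀ j : ℤ, HasSum (fun k : ℤ => F (j, k))
      (w j * q ^ (j * (j + c)) * (qFacInv q (n - j) * qFacInv q (n + c + j))) := by
    intro j
    have hv := (hasSum_qVandermonde hq0 hq (n - j) (2 * j + c)).mul_left (w j * q ^ (j * (j + c)))
    rw [show n - j + (2 * j + c) = n + c + j by ring] at hv
    refine ((Equiv.subRight j).hasSum_iff.2 hv).congr_fun fun k => ?_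
    simp only [Function.comp, Equiv.subRight_apply, F]
    have z1 : q ^ (k * (k + c)) = q ^ (j * (j + c)) * q ^ ((k - j) * (k - j + (2 * j + c))) := by
      rw [← zpow_add₀ hq0]; ring_nf
    rw [z1, show k - j + (2 * j + c) = k + c + j by ring, show n - j - (k - j) = n - k by ring,
      zero_add]
    ring
  have h2 : ∀ k : ℤ, HasSum (fun j : ℤ => F (j, k))
      (q ^ (k * (k + c)) * qFacInv q (n - k) * β k) := fun k =>
    ((h k).mul_left (q ^ (k * (k + c)) * qFacInv q (n - k))).congr_fun fun j => by
      simp only [F]; ring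
  have h3 := hF.hasSum.prod_fiberwise h1
  have h4 := ((Equiv.prodComm ℤ ℤ).hasSum_iff.2 hF.hasSum).prod_fiberwise h2
  rw [h4.tsum_eq]
  exact h3

/-- The unit Bailey pair. -/
theorem hasSum_baileyUnit {s : ℂ} (hs0 : s ≠ 0) (hs : ‖s‖ < 1) {c : ℕ} (hc : c ≤ 1) (n : ℤ) :
    HasSum (fun j : ℤ => s ^ (j ^ 2) * (-s⁻¹) ^ j *
      (qFacInv (s ^ 2) (n - j) * qFacInv (s ^ 2) (n + c + j))) (if n = 0 then 1 else 0) := by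
  have hp : ‖s ^ 2‖ < 1 := by
    rw [norm_pow]; exact pow_lt_one₀ (norm_nonneg s) hs two_ne_zero
  rcases lt_or_ge n 0 with hn | hn
  · rw [if_neg hn.ne]
    convert hasSum_zero using 2 with j
    -- Here c ≤ 1 matters: it makes 2n + c negative, so the two indices cannot both be nonnegative.
    have : n - j < 0 ∨ n + c + j < 0 := by omega
    rcases this with h | h <;> simp [qFacInv_of_neg _ h]
  lift n to ℕ using hn
  -- The choice z = -1/s turns one product into (1;s²)_n, which vanishes as soon as n ≥ 1.
  have h := hasSum_tripleProduct hs0 hs (neg_ne_zero.2 (inv_ne_zero hs0)) n (n + c)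
  rw [show -(-s⁻¹ * s) = 1 by field_simp, show -((-s⁻¹)⁻¹ * s) = s ^ 2 by
    rw [← neg_inv, inv_inv]; ring] at h
  have hv : qFac 1 (s ^ 2) n * qFac (s ^ 2) (s ^ 2) (n + c) / qFac (s ^ 2) (s ^ 2) (n + (n + c)) =
      if (n : ℤ) = 0 then 1 else 0 := by
    rcases n with _ | n
    · simp [qFac_self_ne_zero hp, show qFac 1 (s ^ 2) 0 = 1 from rfl]
    · rw [if_neg (by push_cast; omega)]
      have : qFac 1 (s ^ 2) (n + 1) = 0 :=
        Finset.prod_eq_zero (Finset.mem_range.2 n.succ_pos) (by simp)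
      rw [this]; simp
  rw [hv] at h
  refine h.congr_fun fun j => ?_
  push_cast
  ring

/-- The common form of the two Rogers--Ramanujan identities. -/
theorem rogersRamanujan_aux {s : ℂ} (hs0 : s ≠ 0) (hs : ‖s‖ < 1) {c : ℕ} (hc : c ≤ 1) :
    (∑' n : ℕ, (s ^ 2) ^ (n * (n + c)) / qFac (s ^ 2) (s ^ 2) n) * qFacInf (s ^ 2) (s ^ 2) =
      qTheta (s ^ 5) (-s ^ (4 * c - 1 : ℤ)) := by
  set q := s ^ 2 with hqdef
  have hq0 : q ≠ 0 := pow_ne_zero 2 hs0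
  have hq : ‖q‖ < 1 := by
    rw [hqdef, norm_pow]; exact pow_lt_one₀ (norm_nonneg s) hs two_ne_zero
  have hne := qFacInf_self_ne_zero hq
  -- One Bailey step takes the unit pair to β_n = 1/(q;q)_n. A second gives a finite
  -- Rogers–Ramanujan sum, whose limit n → ∞ is taken on both sides. The two factors q^(j(j+c))
  -- together with s^(j²-j) make up the exponent 5j² + (4c-1)j of s.
  have b1 : ∀ n : ℤ, ∑' k : ℤ, q ^ (k * (k + c)) * qFacInv q (n - k) * (if k = 0 then 1 else 0) =
      qFacInv q n := by
    intro n
    rw [tsum_eq_single 0 fun k hk => by simp [hk]]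
    simp
  have h1 := hasSum_bailey hq0 hq (hasSum_baileyUnit hs0 hs hc)
  simp only [b1] at h1
  have h2 := hasSum_bailey hq0 hq h1
  set a : ℤ → ℂ := fun j => (s ^ 5) ^ (j ^ 2) * (-s ^ (4 * c - 1 : ℤ)) ^ j with ha
  have hz : -s ^ (4 * c - 1 : ℤ) ≠ 0 := neg_ne_zero.2 (zpow_ne_zero _ hs0)
  have hs5 : ‖s ^ 5‖ < 1 := by
    rw [norm_pow]; exact pow_lt_one₀ (norm_nonneg s) hs (by norm_num)
  have hwa : ∀ j : ℤ, s ^ (j ^ 2) * (-s⁻¹) ^ j * q ^ (j * (j + c)) * q ^ (j * (j + c)) = a j := by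
    intro j
    rw [ha, hqdef]
    simp only
    rw [neg_eq_neg_one_mul s⁻¹, neg_eq_neg_one_mul (s ^ (4 * c - 1 : ℤ)), mul_zpow, mul_zpow,
      inv_zpow', ← zpow_natCast s 2, ← zpow_natCast s 5, ← zpow_mul, ← zpow_mul, ← zpow_mul]
    have : s ^ (((2 : ℕ) : ℤ) * (j * (j + c))) * s ^ (((2 : ℕ) : ℤ) * (j * (j + c))) * s ^ (j ^ 2) *
        s ^ (-j) = s ^ (((5 : ℕ) : ℤ) * j ^ 2) * s ^ ((4 * (c : ℤ) - 1) * j) := by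
      simp only [← zpow_add₀ hs0]
      congr 1; push_cast; ring
    linear_combination (-1) ^ j * this
  simp only [hwa] at h2
  have hasum : Summable fun j => ‖a j‖ := summable_norm_qTheta (pow_ne_zero 5 hs0) hs5 hz
  have t1 := tendsto_tsum_qFacInv hq hasum c
  let g : ℤ → ℂ := fun k => q ^ (k * (k + c)) * qFacInv q k
  have hg : Summable fun k => ‖g k‖ := by
    obtain ⟨B, hB0, hB⟩ := exists_norm_qFacInv_le hq
    refine Summable.of_nonneg_of_le (fun _ => norm_nonneg _) (fun k => ?_)
      ((summable_norm_qTheta hq0 hq (zpow_ne_zero c hq0)).mul_right B)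
    simp only [g]
    rw [norm_mul, ← zpow_mul, ← zpow_add₀ hq0, show k * (k + c) = k ^ 2 + c * k by ring]
    gcongr
    exact hB k
  have t2 : Tendsto (fun n : ℕ => ∑' k : ℤ, q ^ (k * (k + c)) * qFacInv q ((n : ℤ) - k) *
      qFacInv q k) atTop (𝓝 (∑' k : ℤ, g k * (qFacInf q q)⁻¹)) := by
    obtain ⟨B, hB0, hB⟩ := exists_norm_qFacInv_le hq
    refine tendsto_tsum_of_dominated_convergence (bound := fun k => ‖g k‖ * B)
      (hg.mul_right _) (fun k => ?_) (Eventually.of_forall fun n k => ?_)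
    · refine (((tendsto_qFacInv hq).comp (tendsto_int_add_atTop (-k))).const_mul (g k)).congr
        fun n => ?_
      simp only [g, Function.comp, ← sub_eq_add_neg]
      ring
    · rw [mul_right_comm, norm_mul]
      gcongr
      exact hB _
  have heq := tendsto_nhds_unique (t1.congr fun n => ?_) t2
  · rw [tsum_mul_right, ← mul_assoc, mul_left_inj' (inv_ne_zero hne), ← div_eq_mul_inv,
      div_eq_iff hne] at heq
    rw [qTheta, heq]
    congr 1
    have hinj : Function.Injective (Nat.cast : ℕ → ℤ) := Nat.cast_injective
    rw [← hinj.tsum_eq (f := g)]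
    · refine tsum_congr fun n => ?_
      simp only [g]
      rw [qFacInv_natCast, div_eq_mul_inv, ← zpow_natCast q]
      push_cast
      rfl
    · intro k hk
      by_contra hneg
      apply hk
      simp only [g]
      rw [qFacInv_of_neg, mul_zero]
      by_contra h0
      exact hneg ⟨k.toNat, by omega⟩
  · rw [← (h2 n).tsum_eq]
    refine tsum_congr fun j => ?_
    push_cast
    ring

theorem rrG_mul_qFacInf {s : ℂ} (hs0 : s ≠ 0) (hs : ‖s‖ < 1) :
    rrG (s ^ 2) * qFacInf (s ^ 2) (s ^ 2) = qTheta (s ^ 5) (-s⁻¹) := by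
  have h := rogersRamanujan_aux hs0 hs (c := 0) (by norm_num)
  simpa [rrG, pow_two] using h

theorem rrH_mul_qFacInf {s : ℂ} (hs0 : s ≠ 0) (hs : ‖s‖ < 1) :
    rrH (s ^ 2) * qFacInf (s ^ 2) (s ^ 2) = qTheta (s ^ 5) (-s ^ 3) := by
  have h := rogersRamanujan_aux hs0 hs (c := 1) le_rfl
  rw [show (4 * ((1 : ℕ) : ℤ) - 1) = ((3 : ℕ) : ℤ) by norm_num, zpow_natCast] at h
  exact h

/-! ### Binary theta series -/

/-- The theta series `∑ ε^k η^l s^(b k² + 2 h k l + a l² + c k + d l)` over `(k, l) ∈ ℤ²`. -/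
noncomputable def binaryTheta (s ε η : ℂ) (a h b c d : ℤ) : ℂ :=
  ∑' p : ℤ × ℤ, ε ^ p.1 * η ^ p.2 *
    s ^ (b * p.1 ^ 2 + 2 * h * p.1 * p.2 + a * p.2 ^ 2 + c * p.1 + d * p.2)

theorem binaryTheta_swap (s ε η : ℂ) (a h b c d : ℤ) :
    binaryTheta s ε η a h b c d = binaryTheta s η ε b h a d c := by
  rw [binaryTheta, binaryTheta, ← (Equiv.prodComm ℤ ℤ).tsum_eq]
  refine tsum_congr fun p => ?_
  simp only [Equiv.prodComm_apply, Prod.fst_swap, Prod.snd_swap]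
  rw [mul_comm (ε ^ p.2)]
  congr 2
  ring

/-- The bijection `(r, (m, l)) ↦ (a m + r - o, l - h m)`. -/
def residueShear (a : ℕ) [NeZero a] (h o : ℤ) : Fin a × (ℤ × ℤ) ≃ ℤ × ℤ where
  toFun p := ((Int.divModEquiv a).symm (p.2.1, p.1) - o, p.2.2 - h * p.2.1)
  invFun p := (((Int.divModEquiv a) (p.1 + o)).2, (((Int.divModEquiv a) (p.1 + o)).1,
    p.2 + h * ((Int.divModEquiv a) (p.1 + o)).1))
  left_inv p := by
    simp only [sub_add_cancel, Equiv.apply_symm_apply]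
  right_inv p := by
    simp only [Prod.mk.eta, Equiv.symm_apply_apply, add_sub_cancel_right]

theorem residueShear_apply (a : ℕ) [NeZero a] (h o : ℤ) (r : Fin a) (m l : ℤ) :
    residueShear a h o (r, (m, l)) = (a * m + ((r : ℕ) - o), l - h * m) := by
  simp only [residueShear, Equiv.coe_fn_mk, Int.divModEquiv_symm_apply]
  congr 1
  ring

theorem tsum_fin_prod {a : ℕ} {f : Fin a × (ℤ × ℤ) → ℂ} {C : Fin a → ℂ} {u v : Fin a → ℤ → ℂ}
    (hf : ∀ r m l, f (r, (m, l)) = C r * (u r m * v r l))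
    (hu : ∀ r, Summable fun m => ‖u r m‖) (hv : ∀ r, Summable fun l => ‖v r l‖) :
    ∑' p, f p = ∑ r, C r * ((∑' m, u r m) * ∑' l, v r l) := by
  have h1 : ∀ r, Summable fun p : ℤ × ℤ => ‖f (r, p)‖ := fun r => by
    refine ((summable_mul_of_summable_norm (hu r) (hv r)).norm.mul_left ‖C r‖).congr fun p => ?_
    rw [show p = (p.1, p.2) from rfl, hf, norm_mul (C r), norm_mul (u r p.1)]
  have h2 : Summable f := by
    refine Summable.of_norm ((summable_prod_of_nonneg fun p => norm_nonneg _).2 ⟨h1, ?_⟩)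
    exact (hasSum_fintype _).summable
  rw [h2.tsum_prod, tsum_fintype]
  refine Finset.sum_congr rfl fun r _ => ?_
  rw [tsum_mul_tsum_of_summable_norm (hu r) (hv r), ← tsum_mul_left]
  exact tsum_congr fun p => hf r p.1 p.2

/-- Splitting a binary theta series by the residue class of `k + o` modulo `a`. -/
theorem binaryTheta_eq_sum {s ε η : ℂ} (hs0 : s ≠ 0) (hs : ‖s‖ < 1) (hε : ε ≠ 0) (hη : η ≠ 0)
    {a : ℕ} (ha : 0 < a) {h b : ℤ} {D : ℕ} (hD : 0 < D) (habD : a * b - h ^ 2 = D) (o c d : ℤ) :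
    binaryTheta s ε η a h b c d = ∑ r ∈ Finset.range a,
      ε ^ (r - o : ℤ) * s ^ (b * (r - o) ^ 2 + c * (r - o) : ℤ) *
        (qTheta (s ^ (a * D)) (ε ^ (a : ℤ) * η ^ (-h) * s ^ (2 * D * (r - o) + a * c - h * d : ℤ)) *
          qTheta (s ^ a) (η * s ^ (2 * h * (r - o) + d : ℤ))) := by
  have : NeZero a := ⟨ha.ne'⟩
  have hpow : ∀ n : ℕ, 0 < n → s ^ n ≠ 0 ∧ ‖s ^ n‖ < 1 := fun n hn =>
    ⟨pow_ne_zero _ hs0, by rw [norm_pow]; exact pow_lt_one₀ (norm_nonneg s) hs hn.ne'⟩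
  obtain ⟨x0, x1⟩ := hpow (a * D) (Nat.mul_pos ha hD)
  obtain ⟨y0, y1⟩ := hpow a ha
  -- Substituting k = am + t and l ↦ l - hm cancels the cross term and leaves aD m² + a l², since ab
  -- - h² = D. The offset o lets the residues be centred at 0, so that opposite ones can be merged
  -- by `qTheta_inv`.
  rw [binaryTheta, ← (residueShear a h o).tsum_eq, ← Fin.sum_univ_eq_sum_range (fun r : ℕ =>
    ε ^ (r - o : ℤ) * s ^ (b * (r - o) ^ 2 + c * (r - o) : ℤ) *
        (qTheta (s ^ (a * D)) (ε ^ (a : ℤ) * η ^ (-h) * s ^ (2 * D * (r - o) + a * c - h * d : ℤ)) *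
          qTheta (s ^ a) (η * s ^ (2 * h * (r - o) + d : ℤ))))]
  refine tsum_fin_prod (fun r m l => ?_) (fun r => summable_norm_qTheta x0 x1 ?_)
    (fun r => summable_norm_qTheta y0 y1 ?_)
  · rw [residueShear_apply]
    simp only
    generalize ((r : ℕ) : ℤ) - o = t
    simp only [mul_zpow, ← zpow_mul, ← zpow_natCast s]
    have e1 : ε ^ (a * m + t) = ε ^ t * ε ^ (a * m) := by rw [← zpow_add₀ hε]; ring_nf
    have e2 : η ^ (l - h * m) = η ^ (-h * m) * η ^ l := by rw [← zpow_add₀ hη]; ring_nf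
    have e3 : s ^ (b * (a * m + t) ^ 2 + 2 * h * (a * m + t) * (l - h * m) + a * (l - h * m) ^ 2 +
        c * (a * m + t) + d * (l - h * m)) = s ^ (b * t ^ 2 + c * t) *
        (s ^ (((a * D : ℕ) : ℤ) * m ^ 2) * s ^ ((2 * D * t + a * c - h * d) * m)) *
        (s ^ (a * l ^ 2) * s ^ ((2 * h * t + d) * l)) := by
      simp only [← zpow_add₀ hs0]
      congr 1
      push_cast
      rw [← habD]
      ring
    rw [e1, e2, e3]
    ring
  · exact mul_ne_zero (mul_ne_zero (zpow_ne_zero _ hε) (zpow_ne_zero _ hη)) (zpow_ne_zero _ hs0)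
  · exact mul_ne_zero hη (zpow_ne_zero _ hs0)

/-! ### Parity dissections and the theta identities obtained from particular binary forms. -/

theorem norm_pow_lt_one {q : ℂ} (hq : ‖q‖ < 1) {n : ℕ} (hn : n ≠ 0) : ‖q ^ n‖ < 1 := by
  rw [norm_pow]; exact pow_lt_one₀ (norm_nonneg q) hq hn

theorem HasSum.int_even_add_odd {f : ℤ → ℂ} {a b : ℂ} (he : HasSum (fun k => f (2 * k)) a)
    (ho : HasSum (fun k => f (2 * k + 1)) b) : HasSum f (a + b) := by
  have := mul_right_injective₀ (two_ne_zero' ℤ)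
  replace ho := ((add_left_injective 1).comp this).hasSum_range_iff.2 ho
  refine (this.hasSum_range_iff.2 he).add_isCompl ?_ ho
  simpa [Function.comp_def] using Int.isCompl_even_odd

theorem qTheta_even_add_odd {x z : ℂ} (hx0 : x ≠ 0) (hx : ‖x‖ < 1) (hz : z ≠ 0) :
    qTheta x z = qTheta (x ^ 4) (z ^ 2) + x * z * qTheta (x ^ 4) (z ^ 2 * x ^ 4) := by
  have h4 := pow_ne_zero 4 hx0
  have h4' := norm_pow_lt_one hx four_ne_zero
  have hz2 := pow_ne_zero 2 hz
  have h1 := hasSum_qTheta h4 h4' hz2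
  have h2 := (hasSum_qTheta h4 h4' (mul_ne_zero hz2 h4)).mul_left (x * z)
  refine (hasSum_qTheta hx0 hx hz).unique (HasSum.int_even_add_odd ?_ ?_)
  · refine h1.congr_fun fun n => ?_
    simp only [← zpow_natCast, ← zpow_mul]
    congr 2; push_cast; ring
  · refine h2.congr_fun fun n => ?_
    have e1 : x ^ ((2 * n + 1) ^ 2) = x * (x ^ (4 * n ^ 2) * x ^ (4 * n)) := by
      rw [← zpow_add₀ hx0, ← zpow_one_add₀ hx0]; ring_nf
    rw [mul_zpow, e1, zpow_add_one₀ hz]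
    simp only [← zpow_natCast, ← zpow_mul]
    push_cast
    ring

/-- Quasi-periodicity at z = -1/x combined with z ↦ z⁻¹ gives θ = -θ. -/
theorem qTheta_neg_eq_zero {x : ℂ} (hx : x ≠ 0) : qTheta x (-x) = 0 := by
  have h := qTheta_mul_sq hx (neg_ne_zero.2 (inv_ne_zero hx))
  rw [show -x⁻¹ * x ^ 2 = -x by field_simp, show x * -x⁻¹ = -1 by field_simp, ← inv_neg,
    qTheta_inv] at h
  linear_combination (-1 / 2) * h

theorem qTheta_pow_four_six {q : ℂ} (hq0 : q ≠ 0) :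
    q ^ 2 * qTheta (q ^ 4) (q ^ 6) = qTheta (q ^ 4) (q ^ 2) := by
  have h := qTheta_mul_sq (pow_ne_zero 4 hq0) (inv_ne_zero (pow_ne_zero 2 hq0))
  rw [qTheta_inv] at h
  rw [← h]
  congr 2 <;> field_simp

theorem qTheta_pow_four_eight {q : ℂ} (hq0 : q ≠ 0) :
    q ^ 4 * qTheta (q ^ 4) (q ^ 8) = qTheta (q ^ 4) 1 := by
  have h := qTheta_mul_sq (pow_ne_zero 4 hq0) one_ne_zero
  rw [← h]
  ring_nf

theorem qTheta_pow_five_eight {q : ℂ} (hq0 : q ≠ 0) :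
    q ^ 3 * qTheta (q ^ 5) (q ^ 8) = qTheta (q ^ 5) (q ^ 2) := by
  have h := qTheta_mul_sq (pow_ne_zero 5 hq0) (inv_ne_zero (pow_ne_zero 2 hq0))
  rw [qTheta_inv] at h
  rw [← h]
  congr 2 <;> field_simp

theorem qTheta_self {q : ℂ} (hq0 : q ≠ 0) (hq : ‖q‖ < 1) :
    qTheta q q = 2 * qTheta (q ^ 4) (q ^ 2) := by
  have h := qTheta_even_add_odd hq0 hq hq0
  rw [← pow_add] at h
  linear_combination h + qTheta_pow_four_six hq0

theorem qTheta_one_eq {q : ℂ} (hq0 : q ≠ 0) (hq : ‖q‖ < 1) :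
    qTheta q 1 = qTheta (q ^ 4) 1 + q * qTheta (q ^ 4) (q ^ 4) := by
  simpa using qTheta_even_add_odd hq0 hq one_ne_zero

theorem qTheta_neg_one_eq {q : ℂ} (hq0 : q ≠ 0) (hq : ‖q‖ < 1) :
    qTheta (-q) 1 = qTheta (q ^ 4) 1 - q * qTheta (q ^ 4) (q ^ 4) := by
  have h := qTheta_one_eq (neg_ne_zero.2 hq0) (by rwa [norm_neg])
  rw [h, show (-q) ^ 4 = q ^ 4 by ring]
  ring

/-- The form 4k² + 2kl + 5l² has determinant 19; it is K² + Kl + 5l² with K = 2k. The two sides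
split k modulo 5 and l modulo 4. -/
theorem theta_sum_pow_five_even {q : ℂ} (hq0 : q ≠ 0) (hq : ‖q‖ < 1) :
    qTheta (q ^ 5) 1 * qTheta (q ^ 95) 1 + 2 * q ^ 4 * (qTheta (q ^ 5) (q ^ 2) *
      qTheta (q ^ 95) (q ^ 38)) + 2 * q ^ 16 * (qTheta (q ^ 5) (q ^ 4) * qTheta (q ^ 95) (q ^ 76)) =
    qTheta (q ^ 4) 1 * qTheta (q ^ 76) 1 + q ^ 20 * (qTheta (q ^ 4) (q ^ 4) *
      qTheta (q ^ 76) (q ^ 76)) + 2 * q ^ 5 * (qTheta (q ^ 4) (q ^ 2) *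
      qTheta (q ^ 76) (q ^ 38)) := by
  have h1 := binaryTheta_eq_sum hq0 hq one_ne_zero one_ne_zero (a := 5) (h := 1) (b := 4) (D := 19)
    (by norm_num) (by norm_num) (by norm_num) 2 0 0
  have h2 := binaryTheta_eq_sum hq0 hq one_ne_zero one_ne_zero (a := 4) (h := 1) (b := 5) (D := 19)
    (by norm_num) (by norm_num) (by norm_num) 1 0 0
  rw [show ((5 : ℕ) : ℤ) = 5 from rfl] at h1
  rw [show ((4 : ℕ) : ℤ) = 4 from rfl, binaryTheta_swap, h1] at h2
  simp [Finset.sum_range_succ] at h2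
  simp only [qTheta_inv] at h2
  linear_combination h2

/-- The linear terms 4k + l come from replacing k by k + 1/2, that is from K = 2k + 1 in K² + Kl +
5l², up to a factor q. -/
theorem theta_sum_pow_five_odd {q : ℂ} (hq0 : q ≠ 0) (hq : ‖q‖ < 1) :
    2 * (qTheta (q ^ 5) q * qTheta (q ^ 95) (q ^ 19)) + 2 * q ^ 8 * (qTheta (q ^ 5) (q ^ 3) *
      qTheta (q ^ 95) (q ^ 57)) + q ^ 24 * (qTheta (q ^ 5) (q ^ 5) * qTheta (q ^ 95) (q ^ 95)) =
    qTheta (q ^ 4) (q ^ 4) * qTheta (q ^ 76) 1 + q ^ 18 * (qTheta (q ^ 4) 1 *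
      qTheta (q ^ 76) (q ^ 76)) + 2 * q ^ 4 * (qTheta (q ^ 4) (q ^ 2) *
      qTheta (q ^ 76) (q ^ 38)) := by
  have h1 := binaryTheta_eq_sum hq0 hq one_ne_zero one_ne_zero (a := 5) (h := 1) (b := 4) (D := 19)
    (by norm_num) (by norm_num) (by norm_num) 2 4 1
  have h2 := binaryTheta_eq_sum hq0 hq one_ne_zero one_ne_zero (a := 4) (h := 1) (b := 5) (D := 19)
    (by norm_num) (by norm_num) (by norm_num) 1 1 4
  rw [show ((5 : ℕ) : ℤ) = 5 from rfl] at h1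
  rw [show ((4 : ℕ) : ℤ) = 4 from rfl, binaryTheta_swap, h1] at h2
  simp [Finset.sum_range_succ] at h2
  simp only [qTheta_inv] at h2
  linear_combination h2 + q ^ 4 * qTheta (q ^ 76) (q ^ 38) * qTheta_pow_four_six hq0 +
    q ^ 18 * qTheta (q ^ 76) (q ^ 76) * qTheta_pow_four_eight hq0

/-- The exponent is k² + 2kl + 5l² + k + l = (k+l)² + (k+l) + 4l², with sign (-1)^l. The right side
uses the new variable k + l, the left splits k modulo 5; one residue class contributes zero. -/
theorem theta_sum_pow_five_alternating {s : ℂ} (hs0 : s ≠ 0) (hs : ‖s‖ < 1) :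
    2 * (qTheta (s ^ 5) (-s) * qTheta (s ^ 20) (-s ^ 4)) + 2 * s ^ 2 * (qTheta (s ^ 5) (-s ^ 3) *
      qTheta (s ^ 20) (-s ^ 12)) = qTheta s s * qTheta (s ^ 4) (-1) := by
  have h1 := binaryTheta_eq_sum hs0 hs one_ne_zero (neg_ne_zero.2 one_ne_zero) (a := 5) (h := 1)
    (b := 1) (D := 4) (by norm_num) (by norm_num) (by norm_num) 2 1 1
  have h2 := binaryTheta_eq_sum hs0 hs (neg_ne_zero.2 one_ne_zero) one_ne_zero (a := 1) (h := 1)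
    (b := 5) (D := 4) (by norm_num) (by norm_num) (by norm_num) 0 1 1
  rw [show ((5 : ℕ) : ℤ) = 5 from rfl] at h1
  rw [show ((1 : ℕ) : ℤ) = 1 from rfl, binaryTheta_swap, h1] at h2
  simp [Finset.sum_range_succ] at h2
  simp only [← inv_neg, qTheta_inv] at h2
  linear_combination h2 - s ^ 6 * qTheta (s ^ 20) (-s ^ 20) * qTheta_neg_eq_zero (pow_ne_zero 5 hs0)

/-- The form k² + 4kl + 5l² = (k+2l)² + l² is a sum of two squares, here also split by k modulo 5.
-/
theorem theta_sq_sub_sq {q : ℂ} (hq0 : q ≠ 0) (hq : ‖q‖ < 1) :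
    qTheta q 1 ^ 2 - qTheta (q ^ 5) 1 ^ 2 =
      4 * q * (qTheta (q ^ 5) (q ^ 2) * qTheta (q ^ 5) (q ^ 4)) := by
  have h1 := binaryTheta_eq_sum hq0 hq one_ne_zero one_ne_zero (a := 5) (h := 2) (b := 1) (D := 1)
    (by norm_num) (by norm_num) (by norm_num) 2 0 0
  have h2 := binaryTheta_eq_sum hq0 hq one_ne_zero one_ne_zero (a := 1) (h := 2) (b := 5) (D := 1)
    (by norm_num) (by norm_num) (by norm_num) 0 0 0
  rw [show ((5 : ℕ) : ℤ) = 5 from rfl] at h1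
  rw [show ((1 : ℕ) : ℤ) = 1 from rfl, binaryTheta_swap, h1] at h2
  simp [Finset.sum_range_succ] at h2
  simp only [qTheta_inv] at h2
  linear_combination -h2 + 2 * q * qTheta (q ^ 5) (q ^ 4) * qTheta_pow_five_eight hq0

/-! ### Infinite products -/

theorem qFacInf_ne_zero {a q : ℂ} (ha : ‖a‖ < 1) (hq : ‖q‖ < 1) : qFacInf a q ≠ 0 := by
  have h : Summable fun k : ℕ => ‖-(a * q ^ k)‖ := by
    simpa [norm_mul, norm_pow] using
      (summable_geometric_of_lt_one (norm_nonneg q) hq).mul_left ‖a‖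
  have h0 : ∀ k : ℕ, 1 + -(a * q ^ k) ≠ 0 := by
    intro k hk
    have h1 : ‖a * q ^ k‖ = 1 := by
      rw [show a * q ^ k = 1 by linear_combination -hk, norm_one]
    rw [norm_mul, norm_pow] at h1
    have := mul_le_of_le_one_right (norm_nonneg a) (pow_le_one₀ (norm_nonneg q) hq.le (n := k))
    linarith
  simpa [qFacInf, sub_eq_add_neg] using tprod_one_add_ne_zero_of_summable h0 h

theorem qFacInf_split_two (a : ℂ) {q : ℂ} (hq : ‖q‖ < 1) :
    qFacInf a q = qFacInf a (q ^ 2) * qFacInf (a * q) (q ^ 2) := by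
  have h : ∀ n, qFac a q (2 * n) = qFac a (q ^ 2) n * qFac (a * q) (q ^ 2) n := by
    intro n
    induction n with
    | zero => simp [qFac]
    | succ n ih =>
      rw [show 2 * (n + 1) = 2 * n + 1 + 1 by ring]
      simp only [qFac_succ, ih]
      ring
  have hq2 := norm_pow_lt_one hq two_ne_zero
  refine tendsto_nhds_unique (((tendsto_qFac a hq).comp (tendsto_id.const_mul_atTop'
    two_pos)).congr h) ((tendsto_qFac _ hq2).mul (tendsto_qFac _ hq2))

theorem qFacInf_split_five (a : ℂ) {q : ℂ} (hq : ‖q‖ < 1) :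
    qFacInf a q = qFacInf a (q ^ 5) * qFacInf (a * q) (q ^ 5) * qFacInf (a * q ^ 2) (q ^ 5) *
      qFacInf (a * q ^ 3) (q ^ 5) * qFacInf (a * q ^ 4) (q ^ 5) := by
  have h : ∀ n, qFac a q (5 * n) = qFac a (q ^ 5) n * qFac (a * q) (q ^ 5) n *
      qFac (a * q ^ 2) (q ^ 5) n * qFac (a * q ^ 3) (q ^ 5) n * qFac (a * q ^ 4) (q ^ 5) n := by
    intro n
    induction n with
    | zero => simp [qFac]
    | succ n ih =>
      rw [show 5 * (n + 1) = 5 * n + 1 + 1 + 1 + 1 + 1 by ring]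
      simp only [qFac_succ, ih]
      ring
  have hq5 := norm_pow_lt_one hq (by norm_num : 5 ≠ 0)
  refine tendsto_nhds_unique (((tendsto_qFac a hq).comp (tendsto_id.const_mul_atTop'
    (by norm_num : 0 < 5))).congr h) (((((tendsto_qFac _ hq5).mul (tendsto_qFac _ hq5)).mul
    (tendsto_qFac _ hq5)).mul (tendsto_qFac _ hq5)).mul (tendsto_qFac _ hq5))

theorem qFacInf_mul_neg (a : ℂ) {q : ℂ} (hq : ‖q‖ < 1) :
    qFacInf a q * qFacInf (-a) q = qFacInf (a ^ 2) (q ^ 2) := by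
  have h : ∀ n, qFac a q n * qFac (-a) q n = qFac (a ^ 2) (q ^ 2) n := by
    intro n
    rw [qFac, qFac, qFac, ← Finset.prod_mul_distrib]
    exact Finset.prod_congr rfl fun k _ => by ring
  exact tendsto_nhds_unique (((tendsto_qFac a hq).mul (tendsto_qFac _ hq)).congr h)
    (tendsto_qFac _ (norm_pow_lt_one hq two_ne_zero))

theorem qFacInf_zero_zero : qFacInf 0 0 = 1 := by simp [qFacInf]

/-- Euler's identity `(q;q²)_∞ (-q;q)_∞ = 1`. -/
theorem qFacInf_euler {q : ℂ} (hq : ‖q‖ < 1) : qFacInf q (q ^ 2) * qFacInf (-q) q = 1 := by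
  have h1 := qFacInf_split_two q hq
  have h2 := qFacInf_mul_neg q hq
  have h3 := qFacInf_self_ne_zero (norm_pow_lt_one hq two_ne_zero)
  rw [← pow_two] at h1
  rw [h1] at h2
  exact mul_right_cancel₀ h3 (by linear_combination h2)

theorem qFacInf_neg_one {q : ℂ} (hq : ‖q‖ < 1) : qFacInf (-1) q = 2 * qFacInf (-q) q := by
  have h : ∀ n, qFac (-1) q (n + 1) = 2 * qFac (-q) q n := by
    intro n
    rw [qFac, qFac, Finset.prod_range_succ', mul_comm]
    congr 1
    · norm_num
    · exact Finset.prod_congr rfl fun k _ => by ring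
  exact tendsto_nhds_unique (((tendsto_qFac (-1) hq).comp (tendsto_add_atTop_nat 1)).congr h)
    ((tendsto_qFac _ hq).const_mul 2)

/-- Continuity serves to resolve a sign in `rrG_rrG_sub_rrH_rrH`. -/
theorem continuousOn_qFacInf_pow (ε : ℂ) (m : ℕ) {n : ℕ} (hn : n ≠ 0) :
    ContinuousOn (fun q : ℂ => qFacInf (ε * q ^ m) (q ^ n)) (Metric.ball 0 1) := by
  intro q₀ hq₀
  obtain ⟨ρ, h1, h2⟩ := exists_between (mem_ball_zero_iff.1 hq₀)
  have hρ0 : 0 ≤ ρ := (norm_nonneg _).trans h1.le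
  have hu : Summable fun k : ℕ => ‖ε‖ * ρ ^ k :=
    (summable_geometric_of_lt_one hρ0 h2).mul_left _
  have h := (Summable.hasProdLocallyUniformlyOn_nat_one_add (Metric.isOpen_ball (x := (0 : ℂ))
    (ε := ρ)) hu (f := fun k q => -(ε * q ^ m * (q ^ n) ^ k)) ?_ ?_)
  · have hc := h.tendstoLocallyUniformlyOn_finsetRange.continuousOn (.of_forall fun N => ?_)
    · refine ((hc.congr fun q _ => ?_).continuousAt (Metric.isOpen_ball.mem_nhds
        (mem_ball_zero_iff.2 h1))).continuousWithinAt
      simp [qFacInf, sub_eq_add_neg]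
    · exact continuousOn_finsetProd _ fun i _ => by fun_prop
  · refine Eventually.of_forall fun k q hq => ?_
    have hq' : ‖q‖ ≤ ρ := (mem_ball_zero_iff.1 hq).le
    have hq1 : ‖q‖ ≤ 1 := hq'.trans h2.le
    rw [norm_neg, mul_assoc, norm_mul, norm_mul, norm_pow, norm_pow, norm_pow]
    have a1 : ‖q‖ ^ m ≤ 1 := pow_le_one₀ (norm_nonneg q) hq1
    have a2 : (‖q‖ ^ n) ^ k ≤ ρ ^ k := by
      gcongr
      exact (pow_le_of_le_one (norm_nonneg q) hq1 hn).trans hq'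
    gcongr
    calc ‖q‖ ^ m * (‖q‖ ^ n) ^ k ≤ 1 * ρ ^ k := by gcongr
      _ = ρ ^ k := one_mul _
  · intro k
    fun_prop

/-! ### Product formulas for the theta series and for `G` and `H` -/

theorem qTheta_one_eq_chi {q : ℂ} (hq0 : q ≠ 0) (hq : ‖q‖ < 1) :
    qTheta q 1 = qFacInf (q ^ 2) (q ^ 2) * chi q ^ 2 := by
  rw [qTheta_eq_prod hq0 hq one_ne_zero, inv_one, one_mul, chi]
  ring

theorem chi_neg_sq_mul {q : ℂ} (hq : ‖q‖ < 1) : chi (-q ^ 2) * qFacInf (-q ^ 2) (q ^ 2) = 1 := by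
  have h := qFacInf_euler (norm_pow_lt_one hq two_ne_zero)
  rw [chi, neg_neg, neg_sq]
  exact h

theorem qTheta_self_mul_chi {q : ℂ} (hq0 : q ≠ 0) (hq : ‖q‖ < 1) :
    qTheta q q * chi (-q ^ 2) ^ 2 = 2 * qFacInf (q ^ 2) (q ^ 2) := by
  rw [qTheta_eq_prod hq0 hq hq0, inv_mul_cancel₀ hq0,
    qFacInf_neg_one (norm_pow_lt_one hq two_ne_zero), ← pow_two]
  have h := chi_neg_sq_mul hq
  generalize chi (-q ^ 2) = c at *
  generalize qFacInf (-q ^ 2) (q ^ 2) = d at *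
  linear_combination (2 * qFacInf (q ^ 2) (q ^ 2)) * (c * d + 1) * h

theorem exists_sq_eq {q : ℂ} (hq0 : q ≠ 0) (hq : ‖q‖ < 1) :
    ∃ s : ℂ, s ≠ 0 ∧ ‖s‖ < 1 ∧ s ^ 2 = q := by
  obtain ⟨s, hs⟩ := IsAlgClosed.exists_pow_nat_eq q two_pos
  refine ⟨s, fun h => hq0 (by rw [← hs, h]; norm_num), ?_, hs⟩
  rw [← hs, norm_pow] at hq
  exact (pow_lt_one_iff_of_nonneg (norm_nonneg s) two_ne_zero).1 hq

theorem qFacInf_self_split_five {q : ℂ} (hq : ‖q‖ < 1) :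
    qFacInf q q = qFacInf q (q ^ 5) * qFacInf (q ^ 2) (q ^ 5) * qFacInf (q ^ 3) (q ^ 5) *
      qFacInf (q ^ 4) (q ^ 5) * qFacInf (q ^ 5) (q ^ 5) := by
  have h := qFacInf_split_five q hq
  rw [← pow_two, ← pow_succ', ← pow_succ', ← pow_succ'] at h
  exact h

/-- The first Rogers--Ramanujan identity. -/
theorem rrG_mul_eq_one {q : ℂ} (hq : ‖q‖ < 1) :
    rrG q * (qFacInf q (q ^ 5) * qFacInf (q ^ 4) (q ^ 5)) = 1 := by
  rcases eq_or_ne q 0 with rfl | hq0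
  · have : rrG 0 = 1 := by
      rw [rrG, tsum_eq_single 0 fun n hn => by simp [hn]]
      simp [qFac]
    simp [this, qFacInf_zero_zero]
  obtain ⟨s, hs0, hs, rfl⟩ := exists_sq_eq hq0 hq
  have h5 := norm_pow_lt_one hs (by norm_num : 5 ≠ 0)
  have h := rrG_mul_qFacInf hs0 hs
  rw [qTheta_eq_prod (pow_ne_zero 5 hs0) h5 (neg_ne_zero.2 (inv_ne_zero hs0)),
    show -(-s⁻¹ * s ^ 5) = (s ^ 2) ^ 2 by field_simp, show -((-s⁻¹)⁻¹ * s ^ 5) = (s ^ 2) ^ 3 by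
    rw [← neg_inv, inv_inv]; ring, show (s ^ 5) ^ 2 = (s ^ 2) ^ 5 by ring,
    qFacInf_self_split_five hq] at h
  have hp : ‖(s ^ 2) ^ 5‖ < 1 := norm_pow_lt_one hq (by norm_num)
  have n2 := qFacInf_ne_zero (norm_pow_lt_one hq (by norm_num : 2 ≠ 0)) hp
  have n3 := qFacInf_ne_zero (norm_pow_lt_one hq (by norm_num : 3 ≠ 0)) hp
  have n5 := qFacInf_self_ne_zero hp
  refine mul_right_cancel₀ (mul_ne_zero (mul_ne_zero n2 n3) n5) ?_
  linear_combination h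

/-- The second Rogers--Ramanujan identity. -/
theorem rrH_mul_eq_one {q : ℂ} (hq : ‖q‖ < 1) :
    rrH q * (qFacInf (q ^ 2) (q ^ 5) * qFacInf (q ^ 3) (q ^ 5)) = 1 := by
  rcases eq_or_ne q 0 with rfl | hq0
  · have : rrH 0 = 1 := by
      rw [rrH, tsum_eq_single 0 fun n hn => by simp [hn]]
      simp [qFac]
    simp [this, qFacInf_zero_zero]
  obtain ⟨s, hs0, hs, rfl⟩ := exists_sq_eq hq0 hq
  have h5 := norm_pow_lt_one hs (by norm_num : 5 ≠ 0)
  have h := rrH_mul_qFacInf hs0 hs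
  rw [qTheta_eq_prod (pow_ne_zero 5 hs0) h5 (neg_ne_zero.2 (pow_ne_zero 3 hs0)),
    show -(-s ^ 3 * s ^ 5) = (s ^ 2) ^ 4 by ring, show -((-s ^ 3)⁻¹ * s ^ 5) = s ^ 2 by
    rw [← neg_inv]; field_simp, show (s ^ 5) ^ 2 = (s ^ 2) ^ 5 by ring,
    qFacInf_self_split_five hq] at h
  have hp : ‖(s ^ 2) ^ 5‖ < 1 := norm_pow_lt_one hq (by norm_num)
  have n1 := qFacInf_ne_zero hq hp
  have n4 := qFacInf_ne_zero (norm_pow_lt_one hq (by norm_num : 4 ≠ 0)) hp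
  have n5 := qFacInf_self_ne_zero hp
  refine mul_right_cancel₀ (mul_ne_zero (mul_ne_zero n1 n4) n5) ?_
  linear_combination h

/-! ### Products of two values of `G`, `H` as single theta series. -/

theorem qFacInf_pow_split_two {q : ℂ} (hq : ‖q‖ < 1) (m : ℕ) {n : ℕ} (hn : n ≠ 0) :
    qFacInf (q ^ m) (q ^ n) = qFacInf (q ^ m) (q ^ (n * 2)) * qFacInf (q ^ (m + n)) (q ^ (n * 2)) := by
  rw [qFacInf_split_two _ (norm_pow_lt_one hq hn), ← pow_add, ← pow_mul]

theorem qFacInf_pow_mul_neg {q : ℂ} (hq : ‖q‖ < 1) (m : ℕ) {n : ℕ} (hn : n ≠ 0) :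
    qFacInf (q ^ m) (q ^ n) * qFacInf (-q ^ m) (q ^ n) = qFacInf (q ^ (m * 2)) (q ^ (n * 2)) := by
  rw [qFacInf_mul_neg _ (norm_pow_lt_one hq hn), ← pow_mul, ← pow_mul]

theorem qFacInf_sq_split_five {q : ℂ} (hq : ‖q‖ < 1) :
    qFacInf (q ^ 2) (q ^ 2) = qFacInf (q ^ 2) (q ^ 10) * qFacInf (q ^ 4) (q ^ 10) *
      qFacInf (q ^ 6) (q ^ 10) * qFacInf (q ^ 8) (q ^ 10) * qFacInf (q ^ 10) (q ^ 10) := by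
  have h := qFacInf_self_split_five (norm_pow_lt_one hq two_ne_zero)
  simpa only [← pow_mul] using h

theorem qTheta_pow_five_eq_prod {q : ℂ} (hq0 : q ≠ 0) (hq : ‖q‖ < 1) {m k l : ℕ} (hk : m + 5 = k)
    (hl : m + l = 5) :
    qTheta (q ^ 5) (q ^ m) =
      qFacInf (q ^ 10) (q ^ 10) * qFacInf (-q ^ k) (q ^ 10) * qFacInf (-q ^ l) (q ^ 10) := by
  rw [qTheta_eq_prod (pow_ne_zero 5 hq0) (norm_pow_lt_one hq (by norm_num)) (pow_ne_zero m hq0),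
    ← pow_add, hk, ← pow_mul, show (q ^ m)⁻¹ * q ^ 5 = q ^ l by
      rw [← hl, pow_add, inv_mul_cancel_left₀ (pow_ne_zero m hq0)]]

/-- Splitting all products to moduli 10 and 20 cancels everything but (q¹⁰;q¹⁰)_∞ and the quotients
(q¹⁴;q²⁰)_∞/(q⁷;q¹⁰)_∞ and (q⁶;q²⁰)_∞/(q³;q¹⁰)_∞, which equal (-q⁷;q¹⁰)_∞ and (-q³;q¹⁰)_∞: a Jacobi
triple product. The next lemma is analogous. -/
theorem rrH_mul_rrG_pow_four {q : ℂ} (hq0 : q ≠ 0) (hq : ‖q‖ < 1) :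
    rrH q * rrG (q ^ 4) * qFacInf (q ^ 2) (q ^ 2) = qTheta (q ^ 5) (q ^ 2) := by
  have hH := rrH_mul_eq_one hq
  have hG := rrG_mul_eq_one (norm_pow_lt_one hq four_ne_zero)
  simp only [← pow_mul] at hG
  norm_num at hG
  rw [qTheta_pow_five_eq_prod hq0 hq (k := 7) (l := 3) rfl rfl, qFacInf_sq_split_five hq]
  rw [qFacInf_pow_split_two hq 2 (by norm_num : 5 ≠ 0),
    qFacInf_pow_split_two hq 3 (by norm_num : 5 ≠ 0)] at hH
  have e4 := qFacInf_pow_split_two hq 4 (by norm_num : 10 ≠ 0)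
  have e6 := qFacInf_pow_split_two hq 6 (by norm_num : 10 ≠ 0)
  have n7 := qFacInf_pow_mul_neg hq 7 (by norm_num : 10 ≠ 0)
  have n3 := qFacInf_pow_mul_neg hq 3 (by norm_num : 10 ≠ 0)
  norm_num at hH e4 e6 n7 n3
  rw [e4, e6, ← n7, ← n3]
  linear_combination (qFacInf (q ^ 10) (q ^ 10) * qFacInf (-q ^ 7) (q ^ 10) *
    qFacInf (-q ^ 3) (q ^ 10)) * (hH * (rrG (q ^ 4) * (qFacInf (q ^ 4) (q ^ 20) *
      qFacInf (q ^ 16) (q ^ 20))) + hG)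

theorem rrG_mul_rrH_pow_four {q : ℂ} (hq0 : q ≠ 0) (hq : ‖q‖ < 1) :
    rrG q * rrH (q ^ 4) * qFacInf (q ^ 2) (q ^ 2) = qTheta (q ^ 5) (q ^ 4) := by
  have hG := rrG_mul_eq_one hq
  have hH := rrH_mul_eq_one (norm_pow_lt_one hq four_ne_zero)
  simp only [← pow_mul] at hH
  norm_num at hH
  rw [qTheta_pow_five_eq_prod hq0 hq (k := 9) (l := 1) rfl rfl, qFacInf_sq_split_five hq]
  have e1 := qFacInf_pow_split_two hq 1 (by norm_num : 5 ≠ 0)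
  have e5 := qFacInf_pow_split_two hq 4 (by norm_num : 5 ≠ 0)
  have e2 := qFacInf_pow_split_two hq 2 (by norm_num : 10 ≠ 0)
  have e8 := qFacInf_pow_split_two hq 8 (by norm_num : 10 ≠ 0)
  have n9 := qFacInf_pow_mul_neg hq 9 (by norm_num : 10 ≠ 0)
  have n1 := qFacInf_pow_mul_neg hq 1 (by norm_num : 10 ≠ 0)
  norm_num at e1 e5 e2 e8 n9 n1
  rw [e1, e5] at hG
  rw [e2, e8, ← n9, ← n1, pow_one]
  linear_combination (qFacInf (q ^ 10) (q ^ 10) * qFacInf (-q ^ 9) (q ^ 10) *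
    qFacInf (-q) (q ^ 10)) * (hG * (rrH (q ^ 4) * (qFacInf (q ^ 8) (q ^ 20) *
      qFacInf (q ^ 12) (q ^ 20))) + hH)

theorem qFacInf_odd_split_two {q : ℂ} (hq : ‖q‖ < 1) (a : ℂ) :
    qFacInf a (-q ^ 5) = qFacInf a (q ^ 10) * qFacInf (-(a * q ^ 5)) (q ^ 10) := by
  rw [qFacInf_split_two _ (by rw [norm_neg]; exact norm_pow_lt_one hq (by norm_num)), mul_neg,
    neg_sq, ← pow_mul]

/-- The base -q⁵ of the products at -q splits into base q¹⁰, after which the factors cancel as for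
(q, q⁴); the companion for `H` is the same. -/
theorem rrG_mul_rrG_neg {q : ℂ} (hq0 : q ≠ 0) (hq : ‖q‖ < 1) :
    rrG q * rrG (-q) * qFacInf (q ^ 2) (q ^ 2) = qTheta (q ^ 5) q := by
  have hG := rrG_mul_eq_one hq
  have hG' := rrG_mul_eq_one (by rwa [norm_neg] : ‖-q‖ < 1)
  rw [show (-q) ^ 5 = -q ^ 5 by ring, show (-q) ^ 4 = q ^ 4 by ring, qFacInf_odd_split_two hq,
    qFacInf_odd_split_two hq, show -(-q * q ^ 5) = q ^ 6 by ring, ← pow_add] at hG'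
  have hT := qTheta_pow_five_eq_prod hq0 hq (m := 1) (k := 6) (l := 4) rfl rfl
  rw [pow_one] at hT
  rw [hT, qFacInf_sq_split_five hq]
  have e1 := qFacInf_pow_split_two hq 1 (by norm_num : 5 ≠ 0)
  have e4 := qFacInf_pow_split_two hq 4 (by norm_num : 5 ≠ 0)
  have e2 := qFacInf_pow_split_two hq 2 (by norm_num : 10 ≠ 0)
  have e8 := qFacInf_pow_split_two hq 8 (by norm_num : 10 ≠ 0)
  have n1 := qFacInf_pow_mul_neg hq 1 (by norm_num : 10 ≠ 0)
  have n9 := qFacInf_pow_mul_neg hq 9 (by norm_num : 10 ≠ 0)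
  have n4 := qFacInf_pow_mul_neg hq 4 (by norm_num : 10 ≠ 0)
  have n6 := qFacInf_pow_mul_neg hq 6 (by norm_num : 10 ≠ 0)
  norm_num at hG' e1 e4 e2 e8 n1 n9 n4 n6
  rw [e1, e4] at hG
  rw [e2, e8, ← n1, ← n9, ← n4, ← n6]
  linear_combination (qFacInf (q ^ 10) (q ^ 10) * qFacInf (-q ^ 6) (q ^ 10) *
    qFacInf (-q ^ 4) (q ^ 10)) * (hG * (rrG (-q) * (qFacInf (-q) (q ^ 10) *
      qFacInf (q ^ 6) (q ^ 10) * (qFacInf (q ^ 4) (q ^ 10) * qFacInf (-q ^ 9) (q ^ 10)))) + hG')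

theorem rrH_mul_rrH_neg {q : ℂ} (hq0 : q ≠ 0) (hq : ‖q‖ < 1) :
    rrH q * rrH (-q) * qFacInf (q ^ 2) (q ^ 2) = qTheta (q ^ 5) (q ^ 3) := by
  have hH := rrH_mul_eq_one hq
  have hH' := rrH_mul_eq_one (by rwa [norm_neg] : ‖-q‖ < 1)
  rw [show (-q) ^ 5 = -q ^ 5 by ring, show (-q) ^ 3 = -q ^ 3 by ring, neg_sq,
    qFacInf_odd_split_two hq, qFacInf_odd_split_two hq, show -(-q ^ 3 * q ^ 5) = q ^ 8 by ring,
    ← pow_add] at hH'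
  rw [qTheta_pow_five_eq_prod hq0 hq (k := 8) (l := 2) rfl rfl, qFacInf_sq_split_five hq]
  have e2 := qFacInf_pow_split_two hq 2 (by norm_num : 5 ≠ 0)
  have e3 := qFacInf_pow_split_two hq 3 (by norm_num : 5 ≠ 0)
  have e4 := qFacInf_pow_split_two hq 4 (by norm_num : 10 ≠ 0)
  have e6 := qFacInf_pow_split_two hq 6 (by norm_num : 10 ≠ 0)
  have n2 := qFacInf_pow_mul_neg hq 2 (by norm_num : 10 ≠ 0)
  have n3 := qFacInf_pow_mul_neg hq 3 (by norm_num : 10 ≠ 0)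
  have n7 := qFacInf_pow_mul_neg hq 7 (by norm_num : 10 ≠ 0)
  have n8 := qFacInf_pow_mul_neg hq 8 (by norm_num : 10 ≠ 0)
  norm_num at hH' e2 e3 e4 e6 n2 n3 n7 n8
  rw [e2, e3] at hH
  rw [e4, e6, ← n2, ← n3, ← n7, ← n8]
  linear_combination (qFacInf (q ^ 10) (q ^ 10) * qFacInf (-q ^ 8) (q ^ 10) *
    qFacInf (-q ^ 2) (q ^ 10)) * (hH * (rrH (-q) * (qFacInf (q ^ 2) (q ^ 10) *
      qFacInf (-q ^ 7) (q ^ 10) * (qFacInf (-q ^ 3) (q ^ 10) * qFacInf (q ^ 8) (q ^ 10)))) + hH')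

/-! ### Ramanujan's two-term identities and the mixed products at q and -q. -/

/-- Ramanujan's identity `G(q) G(q⁴) + q H(q) H(q⁴) = χ(q)²`. -/
theorem rrG_rrG_add_rrH_rrH {q : ℂ} (hq0 : q ≠ 0) (hq : ‖q‖ < 1) :
    rrG q * rrG (q ^ 4) + q * (rrH q * rrH (q ^ 4)) = chi q ^ 2 := by
  obtain ⟨s, hs0, hs, rfl⟩ := exists_sq_eq hq0 hq
  have h4 := norm_pow_lt_one hs four_ne_zero
  have h40 := pow_ne_zero 4 hs0
  -- With s² = q the left side is 2(G(q)G(q⁴) + qH(q)H(q⁴)) times (q;q)_∞(q⁴;q⁴)_∞. The right side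
  -- is expanded by the triple product and reduced to χ(q)² by Euler's identity.
  have h := theta_sum_pow_five_alternating hs0 hs
  have g1 := rrG_mul_qFacInf hs0 hs
  have g4 := rrG_mul_qFacInf h40 h4
  have k1 := rrH_mul_qFacInf hs0 hs
  have k4 := rrH_mul_qFacInf h40 h4
  rw [← inv_neg, qTheta_inv] at g1 g4
  rw [show (s ^ 4) ^ 5 = s ^ 20 by ring, show (s ^ 4) ^ 2 = (s ^ 2) ^ 4 by ring] at g4 k4
  rw [show (s ^ 4) ^ 3 = s ^ 12 by ring] at k4
  have t1 := qTheta_eq_prod hs0 hs hs0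
  have t2 := qTheta_eq_prod h40 h4 (neg_ne_zero.2 one_ne_zero)
  rw [← pow_two, inv_mul_cancel₀ hs0, qFacInf_neg_one hq] at t1
  rw [inv_neg, inv_one, neg_mul, one_mul, neg_neg, show (s ^ 4) ^ 2 = (s ^ 2) ^ 4 by ring,
    show s ^ 4 = (s ^ 2) ^ 2 by ring] at t2
  rw [show s ^ 4 = (s ^ 2) ^ 2 by ring] at h g4
  rw [← g1, ← g4, ← k1, ← k4, t1, t2] at h
  have u1 := qFacInf_split_two (-s ^ 2) hq
  rw [neg_mul, ← pow_two] at u1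
  have u2 := qFacInf_euler (norm_pow_lt_one hq two_ne_zero)
  rw [show ((s ^ 2) ^ 2) ^ 2 = (s ^ 2) ^ 4 by ring] at u2
  have n1 := qFacInf_self_ne_zero hq
  have n4 := qFacInf_self_ne_zero (norm_pow_lt_one hq four_ne_zero)
  rw [u1] at h
  rw [chi]
  refine mul_right_cancel₀ (mul_ne_zero n1 n4) ?_
  generalize qFacInf (-(s ^ 2) ^ 2) ((s ^ 2) ^ 2) = x at *
  generalize qFacInf ((s ^ 2) ^ 2) ((s ^ 2) ^ 4) = y at *
  linear_combination (1 / 2) * h + qFacInf (s ^ 2) (s ^ 2) * qFacInf ((s ^ 2) ^ 4) ((s ^ 2) ^ 4) *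
    qFacInf (-s ^ 2) ((s ^ 2) ^ 2) ^ 2 * (x * y + 1) * u2

theorem continuousOn_rrG : ContinuousOn rrG (Metric.ball 0 1) := by
  have h1 := continuousOn_qFacInf_pow 1 1 (by norm_num : 5 ≠ 0)
  have h4 := continuousOn_qFacInf_pow 1 4 (by norm_num : 5 ≠ 0)
  simp only [one_mul, pow_one] at h1 h4
  refine ((h1.mul h4).inv₀ fun q hq => ?_).congr fun q hq => ?_
  · exact right_ne_zero_of_mul_eq_one (rrG_mul_eq_one (mem_ball_zero_iff.1 hq))
  · exact eq_inv_of_mul_eq_one_left (rrG_mul_eq_one (mem_ball_zero_iff.1 hq))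

theorem continuousOn_rrH : ContinuousOn rrH (Metric.ball 0 1) := by
  have h2 := continuousOn_qFacInf_pow 1 2 (by norm_num : 5 ≠ 0)
  have h3 := continuousOn_qFacInf_pow 1 3 (by norm_num : 5 ≠ 0)
  simp only [one_mul] at h2 h3
  refine ((h2.mul h3).inv₀ fun q hq => ?_).congr fun q hq => ?_
  · exact right_ne_zero_of_mul_eq_one (rrH_mul_eq_one (mem_ball_zero_iff.1 hq))
  · exact eq_inv_of_mul_eq_one_left (rrH_mul_eq_one (mem_ball_zero_iff.1 hq))

theorem rrG_zero : rrG 0 = 1 := by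
  simpa [qFacInf_zero_zero] using rrG_mul_eq_one (q := 0) (by simp)

theorem rrH_zero : rrH 0 = 1 := by
  simpa [qFacInf_zero_zero] using rrH_mul_eq_one (q := 0) (by simp)

theorem chi_zero : chi 0 = 1 := by
  simp [chi, qFacInf_zero_zero]

theorem mapsTo_pow_ball {n : ℕ} (hn : n ≠ 0) :
    Set.MapsTo (fun q : ℂ => q ^ n) (Metric.ball 0 1) (Metric.ball 0 1) := fun _ hq =>
  mem_ball_zero_iff.2 (norm_pow_lt_one (mem_ball_zero_iff.1 hq) hn)

/-- Ramanujan's identity `G(q) G(q⁴) - q H(q) H(q⁴) = φ(q⁵) / (q²;q²)_∞`. -/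
theorem rrG_rrG_sub_rrH_rrH {q : ℂ} (hq0 : q ≠ 0) (hq : ‖q‖ < 1) :
    (rrG q * rrG (q ^ 4) - q * (rrH q * rrH (q ^ 4))) * qFacInf (q ^ 2) (q ^ 2) =
      qTheta (q ^ 5) 1 := by
  have theta : ∀ q : ℂ, q ≠ 0 → ‖q‖ < 1 → qTheta (q ^ 5) 1 =
      qFacInf (q ^ 10) (q ^ 10) * qFacInf (-1 * q ^ 5) (q ^ 10) ^ 2 := fun q hq0 hq => by
    rw [qTheta_one_eq_chi (pow_ne_zero 5 hq0) (norm_pow_lt_one hq (by norm_num)), chi, ← pow_mul,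
      neg_one_mul]
  rw [theta q hq0 hq]
  have c4 : ContinuousOn (fun q : ℂ => q ^ 4) (Metric.ball 0 1) := by fun_prop
  have f2 := continuousOn_qFacInf_pow 1 2 (by norm_num : 2 ≠ 0)
  have f10 := continuousOn_qFacInf_pow 1 10 (by norm_num : 10 ≠ 0)
  simp only [one_mul] at f2 f10
  -- Only the squares are compared, through (A-B)² = (A+B)² - 4AB and `theta_sq_sub_sq`. The sign is
  -- constant because the disc is connected and the right side has no zero, and it is + at q = 0.
  refine (convex_ball (0 : ℂ) 1).isPreconnected.eq_of_sq_eq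
    (f := fun q : ℂ => (rrG q * rrG (q ^ 4) - q * (rrH q * rrH (q ^ 4))) *
      qFacInf (q ^ 2) (q ^ 2))
    (g := fun q : ℂ => qFacInf (q ^ 10) (q ^ 10) * qFacInf (-1 * q ^ 5) (q ^ 10) ^ 2)
    ?_ ?_ ?_ ?_ (y := 0) (by simp) ?_ (mem_ball_zero_iff.2 hq)
  · exact ((continuousOn_rrG.mul (continuousOn_rrG.comp c4 (mapsTo_pow_ball four_ne_zero))).sub
      (continuousOn_id.mul (continuousOn_rrH.mul
        (continuousOn_rrH.comp c4 (mapsTo_pow_ball four_ne_zero))))).mul f2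
  · exact f10.mul ((continuousOn_qFacInf_pow (-1) 5 (by norm_num : 10 ≠ 0)).pow 2)
  · intro p hp
    rcases eq_or_ne p 0 with rfl | hp0
    · simp [rrG_zero, rrH_zero, qFacInf_zero_zero]
    have hp1 := mem_ball_zero_iff.1 hp
    simp only [Pi.pow_apply]
    rw [← theta p hp0 hp1]
    have h := theta_sq_sub_sq hp0 hp1
    rw [qTheta_one_eq_chi hp0 hp1, ← rrG_rrG_add_rrH_rrH hp0 hp1, ← rrH_mul_rrG_pow_four hp0 hp1,
      ← rrG_mul_rrH_pow_four hp0 hp1] at h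
    linear_combination h
  · intro p hp
    have hp1 := mem_ball_zero_iff.1 hp
    have h10 := norm_pow_lt_one hp1 (by norm_num : 10 ≠ 0)
    refine mul_ne_zero (qFacInf_ne_zero h10 h10) (pow_ne_zero _ (qFacInf_ne_zero ?_ h10))
    rw [neg_one_mul, norm_neg]
    exact norm_pow_lt_one hp1 (by norm_num)
  · simp [rrG_zero, rrH_zero, qFacInf_zero_zero]

theorem qTheta_even_part {x z : ℂ} (hx0 : x ≠ 0) (hx : ‖x‖ < 1) (hz : z ≠ 0) :
    qTheta x z + qTheta (-x) z = 2 * qTheta (x ^ 4) (z ^ 2) := by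
  have h1 := qTheta_even_add_odd hx0 hx hz
  have h2 := qTheta_even_add_odd (neg_ne_zero.2 hx0) (by rwa [norm_neg]) hz
  rw [show (-x) ^ 4 = x ^ 4 by ring] at h2
  linear_combination h1 + h2

/-- Put q = p⁴. The even part in p of H(p)G(p⁴)E(p) = θ(p⁵,p²) is, by `rrG_mul_rrG_neg`, a multiple
of G(q), so (H(p) + H(-p))E(p) = 2G(-q)E(q). Multiplying by pH(p⁴) and using 2pH(p)H(p⁴)E(p) =
θ(p,1) - θ(p⁵,1) leaves odd parts of known theta series. -/
theorem rrG_neg_mul_rrH {q : ℂ} (hq0 : q ≠ 0) (hq : ‖q‖ < 1) :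
    2 * (rrG (-q) * rrH q * qFacInf (q ^ 2) (q ^ 2)) =
      qTheta q q - q * qTheta (q ^ 5) (q ^ 5) := by
  obtain ⟨r, hr0, hr, rfl⟩ := exists_sq_eq hq0 hq
  obtain ⟨p, hp0, hp, rfl⟩ := exists_sq_eq hr0 hr
  rw [show (p ^ 2) ^ 2 = p ^ 4 by ring] at *
  have hn0 := neg_ne_zero.2 hp0
  have hn : ‖-p‖ < 1 := by rwa [norm_neg]
  have h20 : (p ^ 5) ^ 4 = (p ^ 4) ^ 5 := by ring
  have e := qTheta_even_part (pow_ne_zero 5 hp0) (norm_pow_lt_one hp (by norm_num))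
    (pow_ne_zero 2 hp0)
  have k1 := rrH_mul_rrG_pow_four hp0 hp
  have k2 := rrH_mul_rrG_pow_four hn0 hn
  have d1 := rrG_rrG_sub_rrH_rrH hp0 hp
  have d2 := rrG_rrG_sub_rrH_rrH hn0 hn
  have s1 := rrG_rrG_add_rrH_rrH hp0 hp
  have s2 := rrG_rrG_add_rrH_rrH hn0 hn
  have t1 := qTheta_one_eq_chi hp0 hp
  have t2 := qTheta_one_eq_chi hn0 hn
  have a1 := qTheta_one_eq hp0 hp
  have a2 := qTheta_neg_one_eq hp0 hp
  have b1 := qTheta_one_eq (pow_ne_zero 5 hp0) (norm_pow_lt_one hp (by norm_num))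
  have b2 := qTheta_neg_one_eq (pow_ne_zero 5 hp0) (norm_pow_lt_one hp (by norm_num))
  rw [show (-p) ^ 5 = -p ^ 5 by ring, neg_sq, show (-p) ^ 4 = p ^ 4 by ring] at *
  rw [show (p ^ 2) ^ 2 = p ^ 4 by ring, h20, ← rrG_mul_rrG_neg hq0 hq] at e
  rw [h20] at b1 b2
  have hG : rrG (p ^ 4) ≠ 0 := left_ne_zero_of_mul_eq_one (rrG_mul_eq_one hq)
  have key : (rrH p + rrH (-p)) * qFacInf (p ^ 2) (p ^ 2) =
      2 * (rrG (-p ^ 4) * qFacInf ((p ^ 4) ^ 2) ((p ^ 4) ^ 2)) :=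
    mul_right_cancel₀ hG (by linear_combination e + k1 + k2)
  refine mul_right_cancel₀ (mul_ne_zero two_ne_zero hp0) ?_
  rw [← s1] at t1
  rw [← s2] at t2
  linear_combination (-2 * p * rrH (p ^ 4)) * key - t1 - d1 + t2 + d2 + a1 - b1 - a2 + b2

/-- Replace q by -q: θ(q,q) = 2θ(q⁴,q²) is even in q, and likewise θ(q⁵,q⁵), so only the explicit
factor q changes sign. -/
theorem rrG_mul_rrH_neg {q : ℂ} (hq0 : q ≠ 0) (hq : ‖q‖ < 1) :
    2 * (rrG q * rrH (-q) * qFacInf (q ^ 2) (q ^ 2)) =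
      qTheta q q + q * qTheta (q ^ 5) (q ^ 5) := by
  have hn0 := neg_ne_zero.2 hq0
  have hn : ‖-q‖ < 1 := by rwa [norm_neg]
  have h := rrG_neg_mul_rrH hn0 hn
  rw [neg_neg, neg_sq, qTheta_self hn0 hn, qTheta_self (pow_ne_zero 5 hn0)
    (norm_pow_lt_one hn (by norm_num)), show (-q) ^ 4 = q ^ 4 by ring, neg_sq,
    show ((-q) ^ 5) ^ 4 = (q ^ 5) ^ 4 by ring, show ((-q) ^ 5) ^ 2 = (q ^ 5) ^ 2 by ring] at h
  rw [qTheta_self hq0 hq, qTheta_self (pow_ne_zero 5 hq0) (norm_pow_lt_one hq (by norm_num)), h]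
  ring

/-! ### Assembly of the two identities for `U(1,19,q)`. -/

theorem rrU_one_nineteen (q : ℂ) :
    rrU 1 19 q = rrG q * rrG (q ^ 19) + q ^ 4 * rrH q * rrH (q ^ 19) := by
  rw [rrU, if_pos (by norm_num), pow_one]
  norm_num

/-- Since θ(±q,1) = θ(q⁴,1) ± qθ(q⁴,q⁴), and likewise for Q, the series in q⁴ and Q⁴ combine into
the even part of θ(q,1)θ(Q,1); the odd part appears in `theta_product_odd`. -/
theorem theta_product_even {q Q : ℂ} (hq0 : q ≠ 0) (hq : ‖q‖ < 1) (hQ : Q = q ^ 19) :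
    2 * (qTheta (q ^ 5) 1 * qTheta (Q ^ 5) 1) + 4 * q ^ 4 * (qTheta (q ^ 5) (q ^ 2) *
      qTheta (Q ^ 5) (Q ^ 2)) + 4 * q ^ 16 * (qTheta (q ^ 5) (q ^ 4) * qTheta (Q ^ 5) (Q ^ 4)) =
    qTheta q 1 * qTheta Q 1 + qTheta (-q) 1 * qTheta (-Q) 1 + q ^ 5 * (qTheta q q * qTheta Q Q) := by
  have hQ0 : Q ≠ 0 := hQ ▸ pow_ne_zero 19 hq0
  have hQ1 : ‖Q‖ < 1 := hQ ▸ norm_pow_lt_one hq (by norm_num)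
  have hL := theta_sum_pow_five_even hq0 hq
  rw [show q ^ 95 = Q ^ 5 by rw [hQ]; ring, show q ^ 38 = Q ^ 2 by rw [hQ]; ring,
    show q ^ 76 = Q ^ 4 by rw [hQ]; ring, show q ^ 20 = q * Q by rw [hQ]; ring] at hL
  rw [qTheta_one_eq hq0 hq, qTheta_one_eq hQ0 hQ1, qTheta_neg_one_eq hq0 hq,
    qTheta_neg_one_eq hQ0 hQ1, qTheta_self hq0 hq, qTheta_self hQ0 hQ1]
  linear_combination 2 * hL

theorem theta_product_odd {q Q : ℂ} (hq0 : q ≠ 0) (hq : ‖q‖ < 1) (hQ : Q = q ^ 19) :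
    4 * q * (qTheta (q ^ 5) q * qTheta (Q ^ 5) Q) + 4 * q ^ 9 * (qTheta (q ^ 5) (q ^ 3) *
      qTheta (Q ^ 5) (Q ^ 3)) + 2 * q ^ 25 * (qTheta (q ^ 5) (q ^ 5) * qTheta (Q ^ 5) (Q ^ 5)) =
    qTheta q 1 * qTheta Q 1 - qTheta (-q) 1 * qTheta (-Q) 1 + q ^ 5 * (qTheta q q * qTheta Q Q) := by
  have hQ0 : Q ≠ 0 := hQ ▸ pow_ne_zero 19 hq0
  have hQ1 : ‖Q‖ < 1 := hQ ▸ norm_pow_lt_one hq (by norm_num)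
  have hL := theta_sum_pow_five_odd hq0 hq
  rw [show q ^ 95 = Q ^ 5 by rw [hQ]; ring, show q ^ 57 = Q ^ 3 by rw [hQ]; ring,
    show q ^ 38 = Q ^ 2 by rw [hQ]; ring, show q ^ 76 = Q ^ 4 by rw [hQ]; ring, ← hQ] at hL
  rw [qTheta_one_eq hq0 hq, qTheta_one_eq hQ0 hQ1, qTheta_neg_one_eq hq0 hq,
    qTheta_neg_one_eq hQ0 hQ1, qTheta_self hq0 hq, qTheta_self hQ0 hQ1]
  linear_combination 2 * q * hL - 2 * qTheta (q ^ 4) 1 * qTheta (Q ^ 4) (Q ^ 4) * hQ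

theorem qTheta_neg_one_eq_chi {q : ℂ} (hq0 : q ≠ 0) (hq : ‖q‖ < 1) :
    qTheta (-q) 1 = qFacInf (q ^ 2) (q ^ 2) * chi (-q) ^ 2 := by
  rw [qTheta_one_eq_chi (neg_ne_zero.2 hq0) (by rwa [norm_neg]), neg_sq]

theorem qFacInf_mul_one_div_chi {q Q : ℂ} (hq0 : q ≠ 0) (hq : ‖q‖ < 1) (hQ0 : Q ≠ 0)
    (hQ : ‖Q‖ < 1) :
    4 * (qFacInf (q ^ 2) (q ^ 2) * qFacInf (Q ^ 2) (Q ^ 2)) *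
      (1 / (chi (-q ^ 2) ^ 2 * chi (-Q ^ 2) ^ 2)) = qTheta q q * qTheta Q Q := by
  have h1 := qTheta_self_mul_chi hq0 hq
  have h2 := qTheta_self_mul_chi hQ0 hQ
  have n1 : chi (-q ^ 2) ≠ 0 := left_ne_zero_of_mul_eq_one (chi_neg_sq_mul hq)
  have n2 : chi (-Q ^ 2) ≠ 0 := left_ne_zero_of_mul_eq_one (chi_neg_sq_mul hQ)
  rw [mul_one_div, div_eq_iff (mul_ne_zero (pow_ne_zero 2 n1) (pow_ne_zero 2 n2))]
  linear_combination -(qTheta Q Q * chi (-Q ^ 2) ^ 2) * h1 - 2 * qFacInf (q ^ 2) (q ^ 2) * h2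

theorem rrU_mul_rrU_pow_four {q Q : ℂ} (hq0 : q ≠ 0) (hq : ‖q‖ < 1) (hQ : Q = q ^ 19) :
    4 * rrU 1 19 q * rrU 1 19 (q ^ 4) =
      3 * chi q ^ 2 * chi Q ^ 2 + chi (-q) ^ 2 * chi (-Q) ^ 2 +
        4 * q ^ 5 * (1 / (chi (-q ^ 2) ^ 2 * chi (-Q ^ 2) ^ 2)) := by
  rw [rrU_one_nineteen, rrU_one_nineteen, show (q ^ 4) ^ 19 = (q ^ 19) ^ 4 by ring, ← hQ]
  have hQ0 : Q ≠ 0 := hQ ▸ pow_ne_zero 19 hq0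
  have hQ1 : ‖Q‖ < 1 := hQ ▸ norm_pow_lt_one hq (by norm_num)
  have n1 := qFacInf_self_ne_zero (norm_pow_lt_one hq two_ne_zero)
  have n2 := qFacInf_self_ne_zero (norm_pow_lt_one hQ1 two_ne_zero)
  have hL := theta_product_even hq0 hq hQ
  have hψ := qFacInf_mul_one_div_chi hq0 hq hQ0 hQ1
  rw [← rrG_rrG_sub_rrH_rrH hq0 hq, ← rrG_rrG_sub_rrH_rrH hQ0 hQ1, ← rrH_mul_rrG_pow_four hq0 hq,
    ← rrH_mul_rrG_pow_four hQ0 hQ1, ← rrG_mul_rrH_pow_four hq0 hq, ← rrG_mul_rrH_pow_four hQ0 hQ1,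
    qTheta_one_eq_chi hq0 hq, qTheta_one_eq_chi hQ0 hQ1, qTheta_neg_one_eq_chi hq0 hq,
    qTheta_neg_one_eq_chi hQ0 hQ1, ← hψ] at hL
  have s1 := rrG_rrG_add_rrH_rrH hq0 hq
  have s2 := rrG_rrG_add_rrH_rrH hQ0 hQ1
  have hqQ : q ^ 20 = q * Q := by rw [hQ]; ring
  refine mul_right_cancel₀ (mul_ne_zero n1 n2) ?_
  -- The term 4(AA' + BB') is 2(A+B)(A'+B') + 2(A-B)(A'-B'). The first half is 2χ(q)²χ(Q)², and `hL`
  -- contributes one more χ(q)²χ(Q)²: hence the 3.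
  linear_combination hL + 2 * qFacInf (q ^ 2) (q ^ 2) * qFacInf (Q ^ 2) (Q ^ 2) *
    ((rrG Q * rrG (Q ^ 4) + Q * (rrH Q * rrH (Q ^ 4))) * s1 + chi q ^ 2 * s2) +
    4 * qFacInf (q ^ 2) (q ^ 2) * qFacInf (Q ^ 2) (Q ^ 2) * rrH q * rrH (q ^ 4) * rrH Q *
      rrH (Q ^ 4) * hqQ

theorem rrU_mul_rrU_neg {q Q : ℂ} (hq0 : q ≠ 0) (hq : ‖q‖ < 1) (hQ : Q = q ^ 19) :
    4 * q * rrU 1 19 q * rrU 1 19 (-q) =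
      chi q ^ 2 * chi Q ^ 2 - chi (-q) ^ 2 * chi (-Q) ^ 2 +
        12 * q ^ 5 * (1 / (chi (-q ^ 2) ^ 2 * chi (-Q ^ 2) ^ 2)) := by
  rw [rrU_one_nineteen, rrU_one_nineteen, show (-q) ^ 19 = -q ^ 19 by ring, ← hQ]
  have hQ0 : Q ≠ 0 := hQ ▸ pow_ne_zero 19 hq0
  have hQ1 : ‖Q‖ < 1 := hQ ▸ norm_pow_lt_one hq (by norm_num)
  have n1 := qFacInf_self_ne_zero (norm_pow_lt_one hq two_ne_zero)
  have n2 := qFacInf_self_ne_zero (norm_pow_lt_one hQ1 two_ne_zero)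
  have hL := theta_product_odd hq0 hq hQ
  have hψ := qFacInf_mul_one_div_chi hq0 hq hQ0 hQ1
  rw [← rrG_mul_rrG_neg hq0 hq, ← rrG_mul_rrG_neg hQ0 hQ1, ← rrH_mul_rrH_neg hq0 hq,
    ← rrH_mul_rrH_neg hQ0 hQ1, qTheta_one_eq_chi hq0 hq, qTheta_one_eq_chi hQ0 hQ1,
    qTheta_neg_one_eq_chi hq0 hq, qTheta_neg_one_eq_chi hQ0 hQ1] at hL
  have w1 := rrG_mul_rrH_neg hq0 hq
  have w2 := rrG_mul_rrH_neg hQ0 hQ1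
  have v1 := rrG_neg_mul_rrH hq0 hq
  have v2 := rrG_neg_mul_rrH hQ0 hQ1
  have hqQ : q ^ 20 = q * Q := by rw [hQ]; ring
  refine mul_right_cancel₀ (mul_ne_zero n1 n2) ?_
  -- With a = θ(q,q) and b = qθ(q⁵,q⁵), the mixed terms give q⁵((a+b)(a'+b') + (a-b)(a'-b')) =
  -- 2q⁵(aa' + bb'). The bb' part supplies the q²⁵ term of `hL`, whose own q⁵aa' makes 3q⁵aa' in
  -- all; `hψ` turns this into the coefficient 12.
  linear_combination hL - 3 * q ^ 5 * hψ +
    q ^ 5 * (w1 * (2 * (rrG Q * rrH (-Q) * qFacInf (Q ^ 2) (Q ^ 2))) +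
      (qTheta q q + q * qTheta (q ^ 5) (q ^ 5)) * w2 +
      v1 * (2 * (rrG (-Q) * rrH Q * qFacInf (Q ^ 2) (Q ^ 2))) +
      (qTheta q q - q * qTheta (q ^ 5) (q ^ 5)) * v2) -
    2 * q ^ 5 * qTheta (q ^ 5) (q ^ 5) * qTheta (Q ^ 5) (Q ^ 5) * hqQ

theorem mainTheorem12 (q Q : ℂ) (hq : ‖q‖ < 1) (hQ : Q = q ^ 19) :
    4 * rrU 1 19 q * rrU 1 19 (q ^ 4) =
        3 * chi q ^ 2 * chi Q ^ 2 + chi (-q) ^ 2 * chi (-Q) ^ 2 +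
          4 * q ^ 5 * (1 / (chi (-q ^ 2) ^ 2 * chi (-Q ^ 2) ^ 2)) ∧
      4 * q * rrU 1 19 q * rrU 1 19 (-q) =
        chi q ^ 2 * chi Q ^ 2 - chi (-q) ^ 2 * chi (-Q) ^ 2 +
          12 * q ^ 5 * (1 / (chi (-q ^ 2) ^ 2 * chi (-Q ^ 2) ^ 2)) := by
  -- The theta manipulations divide by q; at q = 0 the claims read 4 = 3 + 1 and 0 = 1 - 1.
  rcases eq_or_ne q 0 with rfl | hq0
  · subst hQ
    norm_num [rrU_one_nineteen, rrG_zero, chi_zero]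
  · exact ⟨rrU_mul_rrU_pow_four hq0 hq hQ, rrU_mul_rrU_neg hq0 hq hQ⟩
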